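/- **Theorem 3.6 (Main Theorem, W\*-case).** Let $\Gamma$ be a countable group acting non-singularly and essentially freely on standard probability spaces $(X,\mu)$ and $(Y,\nu)$ (each $s\in\Gamma$ acts measurably and preserves the measure class, and for $s\neq e$ the fixed point set of $s$ is null). Let $\pi\colon (Y,\nu)\to(X,\mu)$ be a factor map, i.e. a measurable map which is $\Gamma$-equivariant up to null sets and for which $\pi_*\nu$ and $\mu$ have the same null sets. Via $f\mapsto f\circ\pi$ regard $L^\infty(X)$ as a $\Gamma$-von Neumann subalgebra of $L^\infty(Y)$, where $\Gamma$ acts on $L^\infty(Y)$ by $(s\cdot f)(y)=f(s^{-1}y)$. An intermediate extension of $\pi$ is a triple consisting of a non-singular action of $\Gamma$ on a standard probability space $(Z,\zeta)$ and factor maps $p\colon Y\to Z$, $q\colon Z\to X$ with $q\circ p=\pi$ almost everywhere; two such triples $(Z,p,q)$, $(Z',p',q')$ are identified if there is a $\Gamma$-isomorphism $h\colon Z\to Z'$ (up to null sets, preserving the measure class) with $h\circ p=p'$ and $q=q'\circ h$ almost everywhere. Via $p$, $L^\infty(Z)$ is regarded as the subalgebra $\{f\circ p: f\in L^\infty(Z)\}$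 of $L^\infty(Y)$. For a $\Gamma$-von Neumann subalgebra $N\subset L^\infty(Y)$ let $N\rtimes\Gamma$ be the von Neumann algebra on $\ell^2(\Gamma,L^2(Y))$ generated by the operators $(f\xi)(t)=(t^{-1}\cdot f)\,\xi(t)$, $f\in N$, and $(u_s\xi)(t)=\xi(s^{-1}t)$, $s\in\Gamma$. Then $Z\mapsto L^\infty(Z)$ is a bijection from the set of equivalence classes of intermediate extensions of $\pi$ onto the set of $\Gamma$-invariant von Neumann algebras $N$ with $L^\infty(X)\subset N\subset L^\infty(Y)$, which is a lattice under $N_1\wedge N_2=N_1\cap N_2$ and $N_1\vee N_2=W^*(N_1,N_2)$; and with the lattice structure so obtained on the intermediate extensions, the map $$L^\infty(Z)\longmapsto L^\infty(Z)\rtimes\Gamma$$ is a lattice isomorphism from the lattice of intermediate extensions of $\pi$ onto the lattice of intermediate von Neumann algebras $Q$, $L^\infty(X)\rtimes\Gamma\subset Q\subset L^\infty(Y)\rtimes\Gamma$, with operations $Q_1\wedge Q_2=Q_1\cap Q_2$ and $Q_1\vee Q_2=W^*(Q_1,Q_2)$. Here $W^*(\cdot,\cdot)$ denotes the generated von Neumann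 algebra. -/

import Mathlib

open MeasureTheory Measure
open scoped ENNReal

universe uΓ uX uY uZ w

noncomputable section

namespace CrossedProductLattice


/-! ### Non-singular actions and factor maps -/

section Actions

variable (Γ : Type uΓ) [Group Γ]

/-- A non-singular action: every group element acts by a measurable map that preserves null sets
(in both directions, since `Γ` is a group). -/
class NonsingularAction {X : Type uX} [MeasurableSpace X] [MulAction Γ X] (μ : Measure X) :
    Prop where
  quasi : ∀ s : Γ, QuasiMeasurePreserving (fun x : X => s • x) μ μ

/-- Essential freeness: every nontrivial group element has a null set of fixed points. -/
def EssentiallyFree {X : Type uX} [MeasurableSpace X] [MulAction Γ X] (μ : Measure X) : Prop :=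
  ∀ s : Γ, s ≠ 1 → μ {x : X | s • x = x} = 0

/-- A factor map `(Y, ν) → (Z, ζ)`: a measurable map, equivariant up to null sets, such that the
push-forward of `ν` has the same null sets as `ζ`. -/
structure IsFactorMap {Y : Type uY} {Z : Type uZ} [MeasurableSpace Y] [MeasurableSpace Z]
    [MulAction Γ Y] [MulAction Γ Z] (ν : Measure Y) (ζ : Measure Z) (p : Y → Z) : Prop where
  quasi : QuasiMeasurePreserving p ν ζ
  absolutelyContinuous : ζ ≪ ν.map p
  equivariant : ∀ s : Γ, ∀ᵐ y ∂ν, p (s • y) = s • p y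

variable {Γ}

theorem IsFactorMap.ae_comp {Y : Type uY} {Z : Type uZ} [MeasurableSpace Y] [MeasurableSpace Z]
    [MulAction Γ Y] [MulAction Γ Z] {ν : Measure Y} {ζ : Measure Z} {p : Y → Z}
    (hp : IsFactorMap Γ ν ζ p) {P : Z → Prop} (h : ∀ᵐ z ∂ζ, P z) : ∀ᵐ y ∂ν, P (p y) :=
  hp.quasi.ae h

theorem IsFactorMap.comp {X : Type uX} {Y : Type uY} {Z : Type uZ} [MeasurableSpace X]
    [MeasurableSpace Y] [MeasurableSpace Z] [MulAction Γ X] [MulAction Γ Y] [MulAction Γ Z]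
    {ν : Measure Y} {ζ : Measure Z} {μ : Measure X} {p : Y → Z} {q : Z → X}
    (hq : IsFactorMap Γ ζ μ q) (hp : IsFactorMap Γ ν ζ p) : IsFactorMap Γ ν μ (q ∘ p) where
  quasi := hq.quasi.comp hp.quasi
  absolutelyContinuous := by
    rw [← Measure.map_map hq.quasi.measurable hp.quasi.measurable]
    exact hq.absolutelyContinuous.trans (hp.absolutelyContinuous.map hq.quasi.measurable)
  equivariant s := by
    filter_upwards [hp.equivariant s, hp.ae_comp (hq.equivariant s)] with y h₁ h₂
    simp only [Function.comp_apply, h₁, h₂]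

theorem IsFactorMap.id {Y : Type uY} [MeasurableSpace Y] [MulAction Γ Y] (ν : Measure Y) :
    IsFactorMap Γ ν ν (_root_.id : Y → Y) where
  quasi := .id ν
  absolutelyContinuous := by rw [Measure.map_id]
  equivariant _ := Filter.Eventually.of_forall fun _ => rfl

end Actions

/-! ### The algebra `L^∞` -/

section Linfty

variable {Y : Type uY} {Z : Type uZ} [MeasurableSpace Y] [MeasurableSpace Z]
  {ν : Measure Y} {ζ : Measure Z}

theorem ae_norm_comp_le {p : Y → Z} (hp : QuasiMeasurePreserving p ν ζ) (f : Lp ℂ ∞ ζ) :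
    ∀ᵐ y ∂ν, ‖(f ∘ p) y‖ ≤ ‖f‖ := by
  refine hp.ae (p := fun z => ‖f z‖ ≤ ‖f‖) ?_
  filter_upwards [ae_le_eLpNormEssSup (f := f) (μ := ζ)] with z hz
  rw [← eLpNorm_exponent_top] at hz
  rw [Lp.norm_def, ← toReal_enorm]
  exact ENNReal.toReal_mono (Lp.eLpNorm_ne_top f) hz

theorem memLp_comp {p : Y → Z} (hp : QuasiMeasurePreserving p ν ζ) (f : Lp ℂ ∞ ζ) :
    MemLp (f ∘ p) ∞ ν :=
  memLp_top_of_bound ((Lp.aestronglyMeasurable f).comp_quasiMeasurePreserving hp) ‖f‖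
    (ae_norm_comp_le hp f)

/-- The *-homomorphism `L^∞(Z) → L^∞(Y)`, `f ↦ f ∘ p`. -/
def pullback (p : Y → Z) (hp : QuasiMeasurePreserving p ν ζ) (f : Lp ℂ ∞ ζ) : Lp ℂ ∞ ν :=
  (memLp_comp hp f).toLp (f ∘ p)

theorem norm_pullback_le (p : Y → Z) (hp : QuasiMeasurePreserving p ν ζ) (f : Lp ℂ ∞ ζ) :
    ‖pullback p hp f‖ ≤ ‖f‖ := by
  rw [pullback, Lp.norm_toLp, eLpNorm_exponent_top]
  exact ENNReal.toReal_le_of_le_ofReal (norm_nonneg _)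
    (eLpNormEssSup_le_of_ae_bound (ae_norm_comp_le hp f))

/-- The representation of `L^∞(Y)` on `L²(Y)` by multiplication operators. -/
def mulOp (f : Lp ℂ ∞ ν) : Lp ℂ 2 ν →L[ℂ] Lp ℂ 2 ν :=
  (ContinuousLinearMap.mul ℂ ℂ).holderL ν ∞ 2 2 f

theorem norm_mulOp_le (f : Lp ℂ ∞ ν) : ‖mulOp f‖ ≤ ‖f‖ := by
  refine ContinuousLinearMap.opNorm_le_bound _ (norm_nonneg _) fun g => ?_
  refine ((ContinuousLinearMap.mul ℂ ℂ).norm_holder_apply_apply_le f g).trans ?_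
  gcongr
  exact mul_le_of_le_one_left (norm_nonneg _) (ContinuousLinearMap.opNorm_mul_le ℂ ℂ)

/-- The action of `Γ` on `L^∞(Y)`: `s` maps `f` to `y ↦ f (s⁻¹ y)`. -/
def translate {Γ : Type uΓ} [Group Γ] [MulAction Γ Y] [NonsingularAction Γ ν] (s : Γ)
    (f : Lp ℂ ∞ ν) : Lp ℂ ∞ ν :=
  pullback (fun y : Y => s⁻¹ • y) (NonsingularAction.quasi s⁻¹) f

end Linfty

/-! ### Von Neumann algebras -/

/-- The von Neumann algebra generated by a set `S` of bounded operators: the bicommutant of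
`S ∪ S*`. -/
def generated {H : Type*} [NormedAddCommGroup H] [InnerProductSpace ℂ H] [CompleteSpace H]
    (S : Set (H →L[ℂ] H)) : VonNeumannAlgebra H where
  toStarSubalgebra :=
    StarSubalgebra.centralizer ℂ (StarSubalgebra.centralizer ℂ S : Set (H →L[ℂ] H))
  centralizer_centralizer' := by simp

/-! ### The crossed product, in the left regular representation on `ℓ²(Γ, L²(Y))` -/

section Crossed

/-- The Hilbert space `L²(Y) ⊗ ℓ²(Γ) = ℓ²(Γ, L²(Y))`. -/
abbrev RegularSpace (Γ : Type uΓ) {Y : Type uY} [MeasurableSpace Y] (ν : Measure Y) :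
    Type (max uΓ uY) :=
  lp (fun _ : Γ => Lp ℂ 2 ν) 2

theorem memℓp_diag {ι H : Type*} [NormedAddCommGroup H] [NormedSpace ℂ H]
    (T : ι → H →L[ℂ] H) (C : ℝ) (hT : ∀ i, ‖T i‖ ≤ C) (ξ : lp (fun _ : ι => H) 2) :
    Memℓp (fun i => T i (ξ i)) 2 := by
  refine ((lp.memℓp ξ).const_smul (C : ℂ)).mono' fun i => ?_
  rw [Pi.smul_apply, norm_smul, Complex.norm_real]
  exact ((T i).le_opNorm _).trans
    (mul_le_mul_of_nonneg_right ((hT i).trans (le_abs_self C)) (norm_nonneg _))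

/-- The diagonal operator `(ξ i)ᵢ ↦ (T i (ξ i))ᵢ` on `ℓ²(ι, H)` for a bounded family `T`. -/
def diagOp {ι H : Type*} [NormedAddCommGroup H] [NormedSpace ℂ H]
    (T : ι → H →L[ℂ] H) (C : ℝ) (hT : ∀ i, ‖T i‖ ≤ C) :
    lp (fun _ : ι => H) 2 →L[ℂ] lp (fun _ : ι => H) 2 :=
  LinearMap.mkContinuous
    { toFun := fun ξ => ⟨fun i => T i (ξ i), memℓp_diag T C hT ξ⟩
      map_add' := fun ξ η => by ext i : 2; exact map_add (T i) (ξ i) (η i)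
      map_smul' := fun c ξ => by ext i : 2; exact map_smul (T i) c (ξ i) }
    |C| fun ξ => by
      have h : ‖(⟨fun i => T i (ξ i), memℓp_diag T C hT ξ⟩ : lp (fun _ : ι => H) 2)‖ ≤
          ‖(C : ℂ) • ξ‖ := by
        refine lp.norm_mono (by norm_num) fun i => ?_
        rw [lp.coeFn_smul, Pi.smul_apply, norm_smul, Complex.norm_real]
        exact ((T i).le_opNorm _).trans
          (mul_le_mul_of_nonneg_right ((hT i).trans (le_abs_self C)) (norm_nonneg _))
      rwa [norm_smul, Complex.norm_real] at h

theorem memℓp_reindex {ι H : Type*} [NormedAddCommGroup H] (e : ι ≃ ι)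
    (ξ : lp (fun _ : ι => H) 2) : Memℓp (fun i => ξ (e i)) 2 := by
  refine memℓp_gen ?_
  exact e.summable_iff.mpr ((lp.memℓp ξ).summable (by norm_num))

/-- The operator `(ξ i)ᵢ ↦ (ξ (e i))ᵢ` on `ℓ²(ι, H)` for a permutation `e`. -/
def reindexOp {ι H : Type*} [NormedAddCommGroup H] [NormedSpace ℂ H] (e : ι ≃ ι) :
    lp (fun _ : ι => H) 2 →L[ℂ] lp (fun _ : ι => H) 2 :=
  LinearMap.mkContinuous
    { toFun := fun ξ => ⟨fun i => ξ (e i), memℓp_reindex e ξ⟩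
      map_add' := fun _ _ => rfl
      map_smul' := fun _ _ => rfl }
    1 fun ξ => by
      rw [one_mul]
      refine le_of_eq ?_
      rw [lp.norm_eq_tsum_rpow (by norm_num), lp.norm_eq_tsum_rpow (by norm_num)]
      congr 1
      exact e.tsum_eq fun i => ‖ξ i‖ ^ (2 : ℝ≥0∞).toReal

variable (Γ : Type uΓ) [Group Γ] {Y : Type uY} [MeasurableSpace Y] {ν : Measure Y}

/-- The left regular representation of `f ∈ L^∞(Y)`: the `t`-th coordinate of a vector is
multiplied by the translate of `f` under `t⁻¹`. -/
def coeffOp [MulAction Γ Y] [NonsingularAction Γ ν] (f : Lp ℂ ∞ ν) :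
    RegularSpace Γ ν →L[ℂ] RegularSpace Γ ν :=
  diagOp (fun t : Γ => mulOp (translate t⁻¹ f)) ‖f‖ fun _ =>
    (norm_mulOp_le _).trans (norm_pullback_le _ _ f)

variable {Γ} (ν) in
/-- The implementing unitary `u_s`, with `(u_s ξ)(t) = ξ (s⁻¹ t)`. -/
def groupOp (s : Γ) : RegularSpace Γ ν →L[ℂ] RegularSpace Γ ν :=
  reindexOp (Equiv.mulLeft s⁻¹)

/-- The crossed product `N ⋊ Γ` for a `Γ`-von Neumann subalgebra `N` of `L^∞(Y)`: the von Neumann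
algebra on `ℓ²(Γ, L²(Y))` generated by the copy of `N` and the unitaries `u_s`. -/
def crossedProduct [MulAction Γ Y] [NonsingularAction Γ ν] (N : Set (Lp ℂ ∞ ν)) :
    VonNeumannAlgebra (RegularSpace Γ ν) :=
  generated (coeffOp Γ '' N ∪ Set.range (groupOp (Γ := Γ) ν))

end Crossed

/-! ### Intermediate `Γ`-von Neumann algebras and intermediate extensions -/

section Intermediate

variable (Γ : Type uΓ) [Group Γ] {X : Type uX} {Y : Type uY}
  [MeasurableSpace X] [MeasurableSpace Y] [MulAction Γ X] [MulAction Γ Y]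
  (μ : Measure X) (ν : Measure Y)

/-- An intermediate `Γ`-von Neumann algebra `N` of `L^∞(X) ⊂ L^∞(Y)`, where `L^∞(X)` sits in
`L^∞(Y)` through `π`. -/
@[ext]
structure IntermediateAlgebra [NonsingularAction Γ ν] (π : Y → X)
    (hπ : QuasiMeasurePreserving π ν μ) where
  carrier : Set (Lp ℂ ∞ ν)
  isVonNeumann : ∃ A : VonNeumannAlgebra (Lp ℂ 2 ν), (A : Set _) = mulOp '' carrier
  translate_mem : ∀ (s : Γ), ∀ f ∈ carrier, translate s f ∈ carrier
  base_mem : Set.range (pullback π hπ) ⊆ carrier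

/-- Intermediate algebras are ordered by inclusion. -/
instance [NonsingularAction Γ ν] (π : Y → X) (hπ : QuasiMeasurePreserving π ν μ) :
    PartialOrder (IntermediateAlgebra Γ μ ν π hπ) :=
  PartialOrder.lift IntermediateAlgebra.carrier fun _ _ h => IntermediateAlgebra.ext h

/-- An intermediate extension of `π : (Y, ν) → (X, μ)`: a non-singular action of `Γ` on a standard
probability space `(Z, ζ)` with factor maps `p : Y → Z` and `q : Z → X` such that `q ∘ p = π`
up to null sets. -/
structure IntermediateExtension (π : Y → X) where
  Z : Type w
  [measurableSpace : MeasurableSpace Z]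
  [standardBorel : StandardBorelSpace Z]
  ζ : Measure Z
  [isProbabilityMeasure : IsProbabilityMeasure ζ]
  [mulAction : MulAction Γ Z]
  [nonsingular : NonsingularAction Γ ζ]
  p : Y → Z
  q : Z → X
  isFactorMap_p : IsFactorMap Γ ν ζ p
  isFactorMap_q : IsFactorMap Γ ζ μ q
  comp_eq : q ∘ p =ᵐ[ν] π

attribute [instance] IntermediateExtension.measurableSpace IntermediateExtension.standardBorel
  IntermediateExtension.isProbabilityMeasure IntermediateExtension.mulAction
  IntermediateExtension.nonsingular

variable {Γ μ ν}

namespace IntermediateExtension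

variable {π : Y → X}

/-- The algebra `L^∞(Z)`, regarded as a subalgebra of `L^∞(Y)` through `p`. -/
def linfty (E : IntermediateExtension.{uΓ, uX, uY, w} Γ μ ν π) : Set (Lp ℂ ∞ ν) :=
  Set.range (pullback E.p E.isFactorMap_p.quasi)

/-- Two intermediate extensions are equivalent if there is a `Γ`-isomorphism `h : Z → Z'` of
measure spaces up to null sets (with inverse `k`) such that `h ∘ p = p'` and `q = q' ∘ h`. -/
def Equivalent (E E' : IntermediateExtension.{uΓ, uX, uY, w} Γ μ ν π) : Prop :=
  ∃ (h : E.Z → E'.Z) (k : E'.Z → E.Z),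
    IsFactorMap Γ E.ζ E'.ζ h ∧ IsFactorMap Γ E'.ζ E.ζ k ∧
    (∀ᵐ z ∂E.ζ, k (h z) = z) ∧ (∀ᵐ z ∂E'.ζ, h (k z) = z) ∧
    (∀ᵐ y ∂ν, h (E.p y) = E'.p y) ∧ (∀ᵐ z ∂E.ζ, E.q z = E'.q (h z))

theorem equivalence_equivalent :
    Equivalence (Equivalent (Γ := Γ) (μ := μ) (ν := ν) (π := π)) where
  refl E := ⟨id, id, .id _, .id _, .of_forall fun _ => rfl, .of_forall fun _ => rfl,
    .of_forall fun _ => rfl, .of_forall fun _ => rfl⟩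
  symm := by
    rintro E E' ⟨h, k, hh, hk, hkh, hhk, hp, hq⟩
    refine ⟨k, h, hk, hh, hhk, hkh, ?_, ?_⟩
    · filter_upwards [hp, E.isFactorMap_p.ae_comp hkh] with y h₁ h₂
      rw [← h₁, h₂]
    · filter_upwards [hhk, hk.ae_comp hq] with z h₁ h₂
      rw [h₂, h₁]
  trans := by
    rintro E E' E'' ⟨h, k, hh, hk, hkh, hhk, hp, hq⟩ ⟨h', k', hh', hk', hkh', hhk', hp', hq'⟩
    refine ⟨h' ∘ h, k ∘ k', hh'.comp hh, hk.comp hk', ?_, ?_, ?_, ?_⟩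
    · filter_upwards [hkh, hh.ae_comp hkh'] with z h₁ h₂
      simp only [Function.comp_apply, h₂, h₁]
    · filter_upwards [hhk', hk'.ae_comp hhk] with z h₁ h₂
      simp only [Function.comp_apply, h₂, h₁]
    · filter_upwards [hp, hp'] with y h₁ h₂
      simp only [Function.comp_apply, h₁, h₂]
    · filter_upwards [hq, hh.ae_comp hq'] with z h₁ h₂
      simp only [Function.comp_apply, h₁, h₂]

end IntermediateExtension

variable (Γ μ ν) in
/-- Equivalence of intermediate extensions as a setoid. -/
instance extensionSetoid (π : Y → X) :
    Setoid (IntermediateExtension.{uΓ, uX, uY, w} Γ μ ν π) :=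
  ⟨IntermediateExtension.Equivalent, IntermediateExtension.equivalence_equivalent⟩

variable (Γ μ ν) in
/-- Equivalence classes of intermediate extensions of `π`. -/
abbrev ExtensionClass (π : Y → X) :=
  Quotient (extensionSetoid.{uΓ, uX, uY, w} Γ μ ν π)

end Intermediate

end CrossedProductLattice

end

open CrossedProductLattice

noncomputable section

namespace CrossedProductLattice

open Filter Topology
open scoped ComplexConjugate InnerProductSpace

/-! ### Bounded functions acting on `L²` -/

section Basics

variable {Y : Type uY} [MeasurableSpace Y] {ν : Measure Y}

/-! Two correspondences are composed: extensions with algebras `N`, and algebras `N` with von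
Neumann algebras `Q`. Both rest on a sequential description of von Neumann subalgebras of `L^∞`: on
a finite measure space they are exactly the unital *-subalgebras closed under bounded a.e.
convergent sequences (`isSeqClosedAlgebra_iff`).

Crossed products are handled through matrix entries over `Γ`. An operator `x` lies in `N ⋊ Γ` iff
its entry at `(s, t)` is multiplication by `s⁻¹ · c (s t⁻¹)` for some coefficients `c g ∈ N`
(`IntermediateAlgebra.mem_crossedProduct_iff`). Hence `N` is recovered from `N ⋊ Γ`, inclusions are
reflected, and intersections match.

Surjectivity onto the `Q`'s is where freeness of the action on `X` enters. Cut `X` into finitely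
many cells and form `∑ P_i x P_i`, with `P_i` the indicators of the cells; this stays in `Q`. It
multiplies the entry at `(s, t)` by the indicator of the points `y` for which `π (s y)` and `π (t
y)` share a cell. As the cells separate points, only the diagonal survives, so the copy of the `(1,
1)` entry of `x` lies in `Q` (`coeffOp_mem_of_entry_eq`). Applied to `x u_g⁻¹`, this puts every
coefficient of `x` into `N = {f | coeffOp f ∈ Q}`, whence `Q = N ⋊ Γ`.

For extensions, a standard Borel target embeds in `ℂ`, so inclusions of the algebras `L^∞(Z)` come
from point maps (`IsFactorMap.exists_comp_eq`). Conversely, an `L²`-dense sequence of `N` together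
with `π`, recorded along orbits, maps `Y` equivariantly to a shift space, and the bounded functions
of this map are exactly `N` (`IntermediateExtension.exists_linfty_eq_carrier`). -/

theorem ae_norm_le_norm (f : Lp ℂ ∞ ν) : ∀ᵐ y ∂ν, ‖f y‖ ≤ ‖f‖ :=
  ae_norm_comp_le (QuasiMeasurePreserving.id ν) f

theorem norm_le_of_ae_bound_top {f : Lp ℂ ∞ ν} {C : ℝ} (hC : 0 ≤ C) (h : ∀ᵐ y ∂ν, ‖f y‖ ≤ C) :
    ‖f‖ ≤ C := by
  rw [Lp.norm_def, eLpNorm_exponent_top]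
  exact ENNReal.toReal_le_of_le_ofReal hC (eLpNormEssSup_le_of_ae_bound h)

theorem exists_linfty_eq {h : Y → ℂ} (hm : AEStronglyMeasurable h ν) {C : ℝ}
    (hb : ∀ᵐ y ∂ν, ‖h y‖ ≤ C) : ∃ f : Lp ℂ ∞ ν, f =ᵐ[ν] h :=
  ⟨(memLp_top_of_bound hm C hb).toLp h, MemLp.coeFn_toLp _⟩

theorem mulOp_ae (f : Lp ℂ ∞ ν) (ξ : Lp ℂ 2 ν) : mulOp f ξ =ᵐ[ν] fun y => f y * ξ y :=
  (ContinuousLinearMap.mul ℂ ℂ).coeFn_holder f ξ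

theorem mulOp_eq_of_ae {f : Lp ℂ ∞ ν} {ξ η : Lp ℂ 2 ν} (h : η =ᵐ[ν] fun y => f y * ξ y) :
    mulOp f ξ = η :=
  Lp.ext ((mulOp_ae f ξ).trans h.symm)

/-- The constant function `1` in `L²`. -/
def oneL2 (ν : Measure Y) [IsFiniteMeasure ν] : Lp ℂ 2 ν :=
  (memLp_const (1 : ℂ)).toLp _

theorem oneL2_ae [IsFiniteMeasure ν] : oneL2 ν =ᵐ[ν] fun _ => (1 : ℂ) :=
  MemLp.coeFn_toLp _

theorem mulOp_one_ae [IsFiniteMeasure ν] (f : Lp ℂ ∞ ν) : mulOp f (oneL2 ν) =ᵐ[ν] f := by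
  filter_upwards [mulOp_ae f (oneL2 ν), oneL2_ae (ν := ν)] with y h₁ h₂
  rw [h₁, h₂, mul_one]

theorem mulOp_injective [IsFiniteMeasure ν] :
    Function.Injective (mulOp : Lp ℂ ∞ ν → Lp ℂ 2 ν →L[ℂ] Lp ℂ 2 ν) := by
  intro f g h
  refine Lp.ext ((mulOp_one_ae f).symm.trans ?_)
  rw [h]
  exact mulOp_one_ae g

theorem mulOp_mul {f g h : Lp ℂ ∞ ν} (hh : h =ᵐ[ν] fun y => f y * g y) :
    mulOp f * mulOp g = mulOp h := by
  ext1 ξ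
  change mulOp f (mulOp g ξ) = _
  refine mulOp_eq_of_ae ?_
  filter_upwards [hh, mulOp_ae g ξ, mulOp_ae h ξ] with y h₁ h₂ h₃
  rw [h₂, h₃, h₁, mul_assoc]

theorem mulOp_comm (f g : Lp ℂ ∞ ν) : mulOp f * mulOp g = mulOp g * mulOp f := by
  ext1 ξ
  change mulOp f (mulOp g ξ) = _
  refine mulOp_eq_of_ae ?_
  have : (mulOp g * mulOp f) ξ =ᵐ[ν] fun y => g y * mulOp f ξ y := mulOp_ae g _
  filter_upwards [this, mulOp_ae f ξ, mulOp_ae g ξ] with y h₁ h₂ h₃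
  rw [h₁, h₂, h₃]
  ring

theorem mulOp_add (f g : Lp ℂ ∞ ν) : mulOp (f + g) = mulOp f + mulOp g := by
  simp [mulOp]

theorem mulOp_smul (c : ℂ) (f : Lp ℂ ∞ ν) : mulOp (c • f) = c • mulOp f := by
  simp [mulOp]

theorem mulOp_one {f : Lp ℂ ∞ ν} (h : f =ᵐ[ν] fun _ => (1 : ℂ)) : mulOp f = 1 := by
  ext1 ξ
  refine mulOp_eq_of_ae ?_
  filter_upwards [h] with y h₁
  simp [h₁]

theorem star_mulOp {f g : Lp ℂ ∞ ν} (h : g =ᵐ[ν] fun y => conj (f y)) :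
    star (mulOp f) = mulOp g := by
  rw [ContinuousLinearMap.star_eq_adjoint, eq_comm, ContinuousLinearMap.eq_adjoint_iff]
  intro ξ η
  rw [L2.inner_def, L2.inner_def]
  refine integral_congr_ae ?_
  filter_upwards [h, mulOp_ae g ξ, mulOp_ae f η] with y h₁ h₂ h₃
  rw [h₂, h₃, h₁]
  simp only [RCLike.inner_apply, map_mul, Complex.conj_conj]
  ring

theorem exists_linfty_mul (f g : Lp ℂ ∞ ν) : ∃ h : Lp ℂ ∞ ν, h =ᵐ[ν] fun y => f y * g y := by
  refine exists_linfty_eq (C := ‖f‖ * ‖g‖)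
    ((Lp.aestronglyMeasurable f).mul (Lp.aestronglyMeasurable g)) ?_
  filter_upwards [ae_norm_le_norm f, ae_norm_le_norm g] with y h₁ h₂
  rw [norm_mul]
  gcongr

theorem exists_linfty_conj (f : Lp ℂ ∞ ν) : ∃ h : Lp ℂ ∞ ν, h =ᵐ[ν] fun y => conj (f y) := by
  refine exists_linfty_eq (C := ‖f‖)
    (Complex.continuous_conj.comp_aestronglyMeasurable (Lp.aestronglyMeasurable f)) ?_
  filter_upwards [ae_norm_le_norm f] with y h₁
  simpa using h₁

/-- Dominated convergence in `L²`. -/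
theorem tendsto_L2_of_dominated {F : ℕ → Lp ℂ 2 ν} {f b : Lp ℂ 2 ν} {C : ℝ}
    (hb : ∀ n, ∀ᵐ y ∂ν, ‖F n y‖ ≤ C * ‖b y‖)
    (hlim : ∀ᵐ y ∂ν, Tendsto (fun n => F n y) atTop (𝓝 (f y))) : Tendsto F atTop (𝓝 f) := by
  rw [Lp.tendsto_Lp_iff_tendsto_eLpNorm']
  have hb' : ∀ᵐ y ∂ν, ∀ n, ‖F n y‖ ≤ C * ‖b y‖ := ae_all_iff.2 hb
  have hf : ∀ᵐ y ∂ν, ‖f y‖ ≤ C * ‖b y‖ := by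
    filter_upwards [hb', hlim] with y h₁ h₂
    exact le_of_tendsto h₂.norm (.of_forall h₁)
  have key : Tendsto (fun n => ∫⁻ y, ‖F n y - f y‖ₑ ^ (2 : ℝ) ∂ν) atTop (𝓝 (∫⁻ _, 0 ∂ν)) := by
    refine tendsto_lintegral_of_dominated_convergence'
      (fun y => ‖(2 * C : ℝ) • b y‖ₑ ^ (2 : ℝ)) (fun n => ?_) (fun n => ?_) ?_ ?_
    · exact (((Lp.aestronglyMeasurable (F n)).sub (Lp.aestronglyMeasurable f)).enorm).pow_const _
    · filter_upwards [hb', hf] with y h₁ h₂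
      gcongr
      refine enorm_le_iff_norm_le.2 ?_
      refine (norm_sub_le _ _).trans ?_
      rw [norm_smul]
      calc _ ≤ C * ‖b y‖ + C * ‖b y‖ := add_le_add (h₁ n) h₂
        _ = (2 * C) * ‖b y‖ := by ring
        _ ≤ _ := by gcongr; exact le_abs_self _
    · have := ((Lp.memLp b).const_smul (2 * C : ℝ)).2
      rw [eLpNorm_lt_top_iff_lintegral_rpow_enorm_lt_top (by norm_num) (by norm_num)] at this
      simpa using this.ne
    · filter_upwards [hlim] with y h
      have h' : Tendsto (fun n => ‖F n y - f y‖ₑ) atTop (𝓝 0) := by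
        have := (h.sub_const (f y)).enorm
        simpa using this
      have := (ENNReal.continuous_rpow_const (y := 2)).continuousAt.tendsto.comp h'
      simpa [Function.comp_def] using this
  rw [lintegral_zero] at key
  have h2 := (ENNReal.continuous_rpow_const (y := 1 / 2)).continuousAt.tendsto.comp key
  simp only [eLpNorm_eq_lintegral_rpow_enorm_toReal (p := 2) (by norm_num) (by norm_num),
    ENNReal.toReal_ofNat, Pi.sub_apply]
  simpa [Function.comp_def] using h2

theorem tendsto_mulOp {F : ℕ → Lp ℂ ∞ ν} {f : Lp ℂ ∞ ν} {C : ℝ} (hb : ∀ n, ‖F n‖ ≤ C)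
    (hlim : ∀ᵐ y ∂ν, Tendsto (fun n => F n y) atTop (𝓝 (f y))) (ξ : Lp ℂ 2 ν) :
    Tendsto (fun n => mulOp (F n) ξ) atTop (𝓝 (mulOp f ξ)) := by
  refine tendsto_L2_of_dominated (b := ξ) (C := C) (fun n => ?_) ?_
  · filter_upwards [mulOp_ae (F n) ξ, ae_norm_le_norm (F n)] with y h₁ h₂
    rw [h₁, norm_mul]
    gcongr
    exact h₂.trans (hb n)
  · filter_upwards [hlim, mulOp_ae f ξ, ae_all_iff.2 fun n => mulOp_ae (F n) ξ] with y h₁ h₂ h₃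
    simp only [h₂, h₃]
    exact h₁.mul_const _

/-- `L^∞` is maximal abelian: an operator commuting with all multiplications is a
multiplication. -/
theorem exists_eq_mulOp_of_commute [IsFiniteMeasure ν] {T : Lp ℂ 2 ν →L[ℂ] Lp ℂ 2 ν}
    (hT : ∀ f : Lp ℂ ∞ ν, T * mulOp f = mulOp f * T) : ∃ g : Lp ℂ ∞ ν, T = mulOp g := by
  -- The symbol can only be `T 1`: commutation determines `T` on indicators, hence on a dense
  -- subspace.
  set g := T (oneL2 ν) with hg
  have hind : ∀ (c : ℂ) {s : Set Y} (hs : MeasurableSet s),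
      T (indicatorConstLp 2 hs (measure_ne_top ν s) c) =ᵐ[ν] s.indicator fun y => c * g y := by
    intro c s hs
    have e : mulOp (indicatorConstLp ∞ hs (measure_ne_top ν s) c) (oneL2 ν) =
        indicatorConstLp 2 hs (measure_ne_top ν s) c := by
      refine mulOp_eq_of_ae ?_
      filter_upwards [oneL2_ae (ν := ν),
        indicatorConstLp_coeFn (p := ∞) (hs := hs) (hμs := measure_ne_top ν s) (c := c),
        indicatorConstLp_coeFn (p := 2) (hs := hs) (hμs := measure_ne_top ν s) (c := c)]
        with y h₁ h₂ h₃
      rw [h₁, h₂, h₃, mul_one]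
    rw [← e, ← mul_apply_eq_comp, hT]
    filter_upwards [mulOp_ae (indicatorConstLp ∞ hs (measure_ne_top ν s) c) g,
      indicatorConstLp_coeFn (p := ∞) (hs := hs) (hμs := measure_ne_top ν s) (c := c)]
      with y h₁ h₂
    rw [mul_apply_eq_comp, ← hg, h₁, h₂]
    by_cases hy : y ∈ s <;> simp [hy]
  -- Where `|g| > ‖T‖ + 1`, the indicator `u` of that set would satisfy `(‖T‖ + 1) ‖u‖ ≤ ‖T u‖ ≤ ‖T‖
  -- ‖u‖`, forcing `u = 0`.
  have hbound : ∀ᵐ y ∂ν, ‖g y‖ ≤ ‖T‖ + 1 := by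
    obtain ⟨g', hg'm, hgg'⟩ := Lp.aestronglyMeasurable g
    set s : Set Y := {y | ‖T‖ + 1 < ‖g' y‖} with hs_def
    have hs : MeasurableSet s := measurableSet_lt measurable_const hg'm.norm.measurable
    have h0 : ν s = 0 := by
      by_contra hne
      set u : Lp ℂ 2 ν := indicatorConstLp 2 hs (measure_ne_top ν s) 1 with hu
      have hle : ‖((‖T‖ + 1 : ℝ) : ℂ) • u‖ ≤ ‖T u‖ := by
        refine Lp.norm_le_norm_of_ae_le ?_
        filter_upwards [hind 1 hs, hgg', Lp.coeFn_smul ((‖T‖ + 1 : ℝ) : ℂ) u,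
          indicatorConstLp_coeFn (p := 2) (hs := hs) (hμs := measure_ne_top ν s) (c := (1 : ℂ))]
          with y h₁ h₂ h₃ h₄
        rw [h₁, h₃, Pi.smul_apply, hu, h₄]
        by_cases hy : y ∈ s
        · have : ‖T‖ + 1 < ‖g' y‖ := hy
          simp only [hy, Set.indicator_of_mem, one_mul, h₂, smul_eq_mul, mul_one,
            Complex.norm_real]
          rw [Real.norm_of_nonneg (by positivity)]
          exact this.le
        · simp [hy]
      rw [norm_smul, Complex.norm_real, Real.norm_of_nonneg (by positivity)] at hle
      have hle' := hle.trans (T.le_opNorm u)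
      have hpos : 0 < ‖u‖ := by
        rw [hu, norm_indicatorConstLp (by norm_num) (by norm_num)]
        have : 0 < ν.real s := ENNReal.toReal_pos hne (measure_ne_top ν s)
        exact mul_pos (by simp) (Real.rpow_pos_of_pos this _)
      nlinarith
    have : ∀ᵐ y ∂ν, y ∉ s := measure_eq_zero_iff_ae_notMem.1 h0
    filter_upwards [this, hgg'] with y h₁ h₂
    rw [h₂]
    exact not_lt.1 h₁
  obtain ⟨g₀, hg₀⟩ := exists_linfty_eq (Lp.aestronglyMeasurable g) hbound
  refine ⟨g₀, ?_⟩
  ext1 ξ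
  induction ξ using Lp.induction (p := 2) (hp_ne_top := by norm_num) with
  | @indicatorConst c s hs hμs =>
    rw [Lp.simpleFunc.coe_indicatorConst, eq_comm]
    refine mulOp_eq_of_ae ?_
    filter_upwards [hind c hs, hg₀,
      indicatorConstLp_coeFn (p := 2) (hs := hs) (hμs := hμs.ne) (c := c)] with y h₁ h₂ h₃
    rw [h₁, h₂, h₃]
    by_cases hy : y ∈ s <;> simp [hy, mul_comm]
  | add hf hg _ h₁ h₂ => rw [map_add, map_add, h₁, h₂]
  | isClosed => exact isClosed_eq T.continuous (mulOp g₀).continuous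

end Basics

/-! ### Von Neumann subalgebras of `L^∞` and bounded pointwise convergence -/

section Generated

variable {H : Type*} [NormedAddCommGroup H] [InnerProductSpace ℂ H] [CompleteSpace H]

/-- The commutant of `S ∪ S*` is closed under adjoints, so in the second commutant the condition on
`star T` is automatic. -/
theorem mem_generated {S : Set (H →L[ℂ] H)} {x : H →L[ℂ] H} :
    x ∈ generated S ↔ ∀ T, (∀ a ∈ S, a * T = T * a ∧ star a * T = T * star a) →
      T * x = x * T := by
  change x ∈ StarSubalgebra.centralizer ℂ _ ↔ _
  rw [StarSubalgebra.mem_centralizer_iff]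
  constructor
  · intro h T hT
    exact (h T (StarSubalgebra.mem_centralizer_iff ℂ |>.2 hT)).1
  · intro h T hT
    exact ⟨h T (StarSubalgebra.mem_centralizer_iff ℂ |>.1 hT),
      h (star T) (StarSubalgebra.mem_centralizer_iff ℂ |>.1 (star_mem hT))⟩

theorem subset_generated (S : Set (H →L[ℂ] H)) : S ⊆ generated S := fun x hx =>
  mem_generated.2 fun _ hT => (hT x hx).1.symm

theorem mem_vonNeumannAlgebra_iff {A : VonNeumannAlgebra H} {x : H →L[ℂ] H} :
    x ∈ A ↔ ∀ T, (∀ a ∈ A, a * T = T * a) → T * x = x * T := by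
  rw [← A.commutant_commutant, VonNeumannAlgebra.mem_commutant_iff]
  simp only [VonNeumannAlgebra.mem_commutant_iff, VonNeumannAlgebra.commutant_commutant]

theorem generated_le {S : Set (H →L[ℂ] H)} {A : VonNeumannAlgebra H} (h : S ⊆ A) :
    generated S ≤ A := fun _ hx =>
  mem_vonNeumannAlgebra_iff.2 fun T hT => mem_generated.1 hx T fun a ha =>
    ⟨hT a (h ha), hT _ (star_mem (show a ∈ A from h ha))⟩

theorem generated_mono {S T : Set (H →L[ℂ] H)} (h : S ⊆ T) : generated S ≤ generated T :=
  generated_le (h.trans (subset_generated T))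

theorem smul_mem_vonNeumannAlgebra {A : VonNeumannAlgebra H} {x : H →L[ℂ] H} (c : ℂ)
    (hx : x ∈ A) : c • x ∈ A :=
  A.toStarSubalgebra.smul_mem hx c

end Generated

section SeqClosed

variable {Y : Type uY} [MeasurableSpace Y] {ν : Measure Y}

/-- A unital *-subalgebra of `L^∞` that is closed under limits of bounded sequences converging
almost everywhere. -/
structure IsSeqClosedAlgebra (N : Set (Lp ℂ ∞ ν)) : Prop where
  one_mem : ∀ h : Lp ℂ ∞ ν, h =ᵐ[ν] (fun _ => (1 : ℂ)) → h ∈ N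
  add_mem : ∀ f ∈ N, ∀ g ∈ N, f + g ∈ N
  smul_mem : ∀ c : ℂ, ∀ f ∈ N, c • f ∈ N
  mul_mem : ∀ f ∈ N, ∀ g ∈ N, ∀ h : Lp ℂ ∞ ν, h =ᵐ[ν] (fun y => f y * g y) → h ∈ N
  conj_mem : ∀ f ∈ N, ∀ h : Lp ℂ ∞ ν, h =ᵐ[ν] (fun y => conj (f y)) → h ∈ N
  lim_mem : ∀ (F : ℕ → Lp ℂ ∞ ν) (f : Lp ℂ ∞ ν) (C : ℝ), (∀ n, F n ∈ N) → (∀ n, ‖F n‖ ≤ C) →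
    (∀ᵐ y ∂ν, Tendsto (fun n => F n y) atTop (𝓝 (f y))) → f ∈ N

namespace IsSeqClosedAlgebra

/-- Continuous functional calculus by Stone–Weierstrass: the `ψ` on a closed ball with `ψ ∘ f ∈ N`
form a *-subalgebra that contains the inclusion into `ℂ`, hence is dense, and uniform limits are
bounded pointwise limits. -/
theorem mem_of_eq_comp {N : Set (Lp ℂ ∞ ν)} (hN : IsSeqClosedAlgebra N) {f : Lp ℂ ∞ ν}
    (hf : f ∈ N) {φ : ℂ → ℂ} (hφ : Continuous φ) {h : Lp ℂ ∞ ν} (hh : h =ᵐ[ν] φ ∘ f) :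
    h ∈ N := by
  set K : Set ℂ := Metric.closedBall 0 ‖f‖
  have : CompactSpace K := isCompact_iff_compactSpace.1 (isCompact_closedBall _ _)
  -- A representative of `f` with values in the ball everywhere, reset to `0` on the exceptional
  -- null set.
  obtain ⟨F, hFm, hF⟩ : ∃ F : Y → K, Measurable F ∧ ∀ᵐ y ∂ν, (F y : ℂ) = f y := by
    obtain ⟨f', hf'm, hff'⟩ := Lp.aestronglyMeasurable f
    have hmem : ∀ y, (if ‖f' y‖ ≤ ‖f‖ then f' y else 0) ∈ K := by
      intro y
      split_ifs with hy
      · simpa [K] using hy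
      · simp [K]
    refine ⟨fun y => ⟨_, hmem y⟩, Measurable.subtype_mk
      (Measurable.ite (measurableSet_le hf'm.norm.measurable measurable_const) hf'm.measurable
        measurable_const), ?_⟩
    filter_upwards [hff', ae_norm_le_norm f] with y h₁ h₂
    rw [h₁] at h₂ ⊢
    simp [h₂]
  have hex : ∀ ψ : C(K, ℂ), ∃ g : Lp ℂ ∞ ν, g =ᵐ[ν] ψ ∘ F := fun ψ =>
    exists_linfty_eq (C := ‖ψ‖) (ψ.continuous.measurable.comp hFm).aestronglyMeasurable
      (.of_forall fun y => ψ.norm_coe_le_norm _)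
  let S : StarSubalgebra ℂ C(K, ℂ) :=
    { carrier := {ψ | ∀ g : Lp ℂ ∞ ν, g =ᵐ[ν] ψ ∘ F → g ∈ N}
      mul_mem' := by
        intro a b ha hb g hg
        obtain ⟨a', ha'⟩ := hex a
        obtain ⟨b', hb'⟩ := hex b
        refine hN.mul_mem a' (ha a' ha') b' (hb b' hb') g ?_
        filter_upwards [hg, ha', hb'] with y h₁ h₂ h₃
        simp [h₁, h₂, h₃]
      add_mem' := by
        intro a b ha hb g hg
        obtain ⟨a', ha'⟩ := hex a
        obtain ⟨b', hb'⟩ := hex b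
        have : g = a' + b' := by
          refine Lp.ext ?_
          filter_upwards [hg, ha', hb', Lp.coeFn_add a' b'] with y h₁ h₂ h₃ h₄
          rw [h₁, h₄, Pi.add_apply, h₂, h₃]
          simp
        rw [this]
        exact hN.add_mem a' (ha a' ha') b' (hb b' hb')
      algebraMap_mem' := by
        intro c g hg
        obtain ⟨e, he⟩ := hex 1
        have : g = c • e := by
          refine Lp.ext ?_
          filter_upwards [hg, he, Lp.coeFn_smul c e] with y h₁ h₂ h₃
          simp [h₁, h₂, h₃]
        rw [this]
        exact hN.smul_mem c e (hN.one_mem e he)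
      star_mem' := by
        intro a ha g hg
        obtain ⟨a', ha'⟩ := hex a
        refine hN.conj_mem a' (ha a' ha') g ?_
        filter_upwards [hg, ha'] with y h₁ h₂
        simp [h₁, h₂] }
  have hid : (⟨fun z => (z : ℂ), continuous_subtype_val⟩ : C(K, ℂ)) ∈ S := by
    intro g hg
    have : g = f := Lp.ext (by
      filter_upwards [hg, hF] with y h₁ h₂
      rw [h₁]
      exact h₂)
    rwa [this]
  have htop := ContinuousMap.starSubalgebra_topologicalClosure_eq_top_of_separatesPoints S
    (fun a b hab => ⟨_, ⟨_, hid, rfl⟩, fun h => hab (Subtype.ext h)⟩)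
  have hmem : (⟨fun z => φ z, hφ.comp continuous_subtype_val⟩ : C(K, ℂ)) ∈
      closure (S : Set C(K, ℂ)) := by
    rw [← StarSubalgebra.topologicalClosure_coe, htop]
    trivial
  obtain ⟨ψ, hψS, hψ⟩ := mem_closure_iff_seq_limit.1 hmem
  choose G hG using fun n => hex (ψ n)
  obtain ⟨C, hC⟩ := (Metric.isBounded_range_of_tendsto ψ hψ).exists_norm_le
  have hC0 : 0 ≤ C := (norm_nonneg _).trans (hC _ ⟨0, rfl⟩)
  refine hN.lim_mem G h C (fun n => hψS n _ (hG n)) (fun n => ?_) ?_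
  · refine norm_le_of_ae_bound_top hC0 ?_
    filter_upwards [hG n] with y h₁
    rw [h₁]
    exact ((ψ n).norm_coe_le_norm _).trans (hC _ ⟨n, rfl⟩)
  · filter_upwards [hh, ae_all_iff.2 hG, hF] with y h₁ h₂ h₃
    simp only [h₁, h₂, Function.comp_apply, ← h₃]
    exact ((ContinuousEvalConst.continuous_eval_const (F y)).tendsto _).comp hψ

theorem conj_exists_mem {N : Set (Lp ℂ ∞ ν)} (hN : IsSeqClosedAlgebra N) {f : Lp ℂ ∞ ν}
    (hf : f ∈ N) : ∃ g ∈ N, star (mulOp f) = mulOp g := by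
  obtain ⟨g, hg⟩ := exists_linfty_conj f
  exact ⟨g, hN.conj_mem f hf g hg, star_mulOp hg⟩

variable [IsFiniteMeasure ν]

/-- Plays the role of Kaplansky density. An `L²`-convergent sequence from `N` has an a.e. convergent
subsequence but need not be bounded; composing with a radial retraction onto a ball keeps it in `N`,
bounds it, and does not move the limit `f`. -/
theorem mem_of_mem_closure {N : Set (Lp ℂ ∞ ν)} (hN : IsSeqClosedAlgebra N) {f : Lp ℂ ∞ ν}
    (hf : mulOp f (oneL2 ν) ∈ closure ((fun g => mulOp g (oneL2 ν)) '' N)) : f ∈ N := by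
  obtain ⟨u, huN, hu⟩ := mem_closure_iff_seq_limit.1 hf
  choose n hnN hn using huN
  obtain ⟨ns, -, hns⟩ := (tendstoInMeasure_of_tendsto_Lp hu).exists_seq_tendsto_ae
  -- Any radius at least `‖f‖` would do; adding `1` makes it positive even when `f = 0`.
  set M : ℝ := ‖f‖ + 1
  have hM : 0 < M := by positivity
  set φ : ℂ → ℂ := fun z => ((M / max M ‖z‖ : ℝ) : ℂ) * z with hφdef
  have hmax : ∀ z : ℂ, 0 < max M ‖z‖ := fun z => hM.trans_le (le_max_left _ _)
  have hφ : Continuous φ := by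
    refine (Complex.continuous_ofReal.comp (continuous_const.div
      (continuous_const.max continuous_norm) fun z => (hmax z).ne')).mul continuous_id
  have hφb : ∀ z, ‖φ z‖ ≤ M := by
    intro z
    rw [hφdef]
    simp only [norm_mul, Complex.norm_real, norm_div]
    rw [Real.norm_of_nonneg hM.le, Real.norm_of_nonneg (hmax z).le, div_mul_eq_mul_div,
      div_le_iff₀ (hmax z)]
    gcongr
    exact le_max_right _ _
  have hφid : ∀ z, ‖z‖ ≤ M → φ z = z := by
    intro z hz
    simp [hφdef, max_eq_left hz, hM.ne']
  have hex : ∀ k, ∃ h : Lp ℂ ∞ ν, h =ᵐ[ν] φ ∘ n k := fun k =>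
    exists_linfty_eq (hφ.comp_aestronglyMeasurable (Lp.aestronglyMeasurable _))
      (.of_forall fun y => hφb _)
  choose h hh using hex
  refine hN.lim_mem (fun k => h (ns k)) f M (fun k => hN.mem_of_eq_comp (hnN _) hφ (hh _))
    (fun k => norm_le_of_ae_bound_top hM.le ?_) ?_
  · filter_upwards [hh (ns k)] with y h₁
    rw [h₁]
    exact hφb _
  · filter_upwards [hns, ae_all_iff.2 hh, mulOp_one_ae f, ae_norm_le_norm f,
      ae_all_iff.2 fun k => mulOp_one_ae (n k)] with y h₁ h₂ h₃ h₄ h₅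
    have e : ∀ k, u (ns k) y = n (ns k) y := fun k => by rw [← hn, h₅]
    simp only [e, h₃] at h₁
    simp only [h₂]
    have := (hφ.tendsto (f y)).comp h₁
    rwa [hφid _ (h₄.trans (by simp [M]))] at this

/-- Multiplications commute with `N`, so an element of the bicommutant commutes with all of them and
is some `mulOp f`. The projection onto the closure of `N · 1` commutes with `N`, hence with `mulOp
f`; so `f · 1` lies in that closure. -/
theorem coe_generated {N : Set (Lp ℂ ∞ ν)} (hN : IsSeqClosedAlgebra N) :
    (generated (mulOp '' N) : Set (Lp ℂ 2 ν →L[ℂ] Lp ℂ 2 ν)) = mulOp '' N := by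
  refine Set.Subset.antisymm (fun x hx => ?_) (subset_generated _)
  rw [SetLike.mem_coe, mem_generated] at hx
  have hcomm : ∀ T : Lp ℂ 2 ν →L[ℂ] Lp ℂ 2 ν, (∀ n ∈ N, mulOp n * T = T * mulOp n) →
      T * x = x * T := by
    refine fun T hT => hx T ?_
    rintro _ ⟨n, hn, rfl⟩
    obtain ⟨m, hm, e⟩ := hN.conj_exists_mem hn
    exact ⟨hT n hn, by rw [e]; exact hT m hm⟩
  obtain ⟨f, rfl⟩ := exists_eq_mulOp_of_commute (T := x)
    fun f => (hcomm _ fun n _ => mulOp_comm n f).symm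
  refine ⟨f, ?_, rfl⟩
  let K₀ : Submodule ℂ (Lp ℂ 2 ν) :=
    { carrier := (fun g => mulOp g (oneL2 ν)) '' N
      add_mem' := by
        rintro _ _ ⟨a, ha, rfl⟩ ⟨b, hb, rfl⟩
        exact ⟨a + b, hN.add_mem a ha b hb, by simp [mulOp_add]⟩
      zero_mem' := by
        obtain ⟨e, he⟩ := exists_linfty_eq (ν := ν) (h := fun _ => 1) (C := 1)
          aestronglyMeasurable_const (by simp)
        exact ⟨(0 : ℂ) • e, hN.smul_mem 0 e (hN.one_mem e he), by simp [mulOp]⟩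
      smul_mem' := by
        rintro c _ ⟨a, ha, rfl⟩
        exact ⟨c • a, hN.smul_mem c a ha, by simp [mulOp_smul]⟩ }
  let K := K₀.topologicalClosure
  have : CompleteSpace K := (K₀.isClosed_topologicalClosure).completeSpace_coe
  have hinv : ∀ n ∈ N, ∀ k ∈ K, mulOp n k ∈ K := by
    intro n hn k hk
    refine map_mem_closure (mulOp n).continuous hk ?_
    rintro _ ⟨a, ha, rfl⟩
    obtain ⟨b, hb⟩ := exists_linfty_mul n a
    exact ⟨b, hN.mul_mem n hn a ha b hb, by simp only [← mulOp_mul hb]; rfl⟩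
  have hP : ∀ n ∈ N, mulOp n * K.starProjection = K.starProjection * mulOp n := by
    intro n hn
    ext1 ξ
    change mulOp n (K.starProjection ξ) = K.starProjection (mulOp n ξ)
    refine (Submodule.eq_starProjection_of_mem_of_inner_eq_zero
      (hinv n hn _ (Submodule.starProjection_apply_mem _ _)) fun k hk => ?_).symm
    obtain ⟨m, hm, e⟩ := hN.conj_exists_mem hn
    rw [← map_sub, ← ContinuousLinearMap.adjoint_inner_right,
      ← ContinuousLinearMap.star_eq_adjoint, e]
    exact Submodule.starProjection_inner_eq_zero _ _ (hinv m hm k hk)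
  have h1 : oneL2 ν ∈ K := by
    obtain ⟨e, he⟩ := exists_linfty_eq (ν := ν) (h := fun _ => 1) (C := 1)
      aestronglyMeasurable_const (by simp)
    exact K₀.le_topologicalClosure ⟨e, hN.one_mem e he, by simp [mulOp_one he]⟩
  have hfK : mulOp f (oneL2 ν) ∈ K := by
    have h2 := DFunLike.congr_fun (hcomm _ hP) (oneL2 ν)
    change K.starProjection (mulOp f (oneL2 ν)) = mulOp f (K.starProjection (oneL2 ν)) at h2
    rw [Submodule.starProjection_eq_self_iff.2 h1] at h2
    exact Submodule.starProjection_eq_self_iff.1 h2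
  exact hN.mem_of_mem_closure hfK

end IsSeqClosedAlgebra

/-- Bounded a.e. convergence gives strong convergence of multiplication operators, under which
commutation relations persist; the other direction is the bicommutant computation in
`coe_generated`. -/
theorem isSeqClosedAlgebra_iff [IsFiniteMeasure ν] {N : Set (Lp ℂ ∞ ν)} :
    IsSeqClosedAlgebra N ↔ ∃ A : VonNeumannAlgebra (Lp ℂ 2 ν), (A : Set _) = mulOp '' N := by
  refine ⟨fun hN => ⟨_, hN.coe_generated⟩, ?_⟩
  rintro ⟨A, hA⟩
  have mem : ∀ f, f ∈ N ↔ mulOp f ∈ A := by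
    intro f
    rw [← SetLike.mem_coe, hA, mulOp_injective.mem_set_image]
  refine ⟨fun h hh => ?_, fun f hf g hg => ?_, fun c f hf => ?_, fun f hf g hg h hh => ?_,
    fun f hf h hh => ?_, fun F f C hF hC hlim => ?_⟩
  · rw [mem, mulOp_one hh]
    exact one_mem A
  · rw [mem] at *
    rw [mulOp_add]
    exact add_mem hf hg
  · rw [mem] at *
    rw [mulOp_smul]
    exact smul_mem_vonNeumannAlgebra c hf
  · rw [mem] at *
    rw [← mulOp_mul hh]
    exact mul_mem hf hg
  · rw [mem] at *
    rw [← star_mulOp hh]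
    exact star_mem hf
  · rw [mem, mem_vonNeumannAlgebra_iff]
    intro T hT
    ext1 ξ
    refine tendsto_nhds_unique ((T.continuous.tendsto _).comp (tendsto_mulOp hC hlim ξ)) ?_
    refine (tendsto_mulOp hC hlim (T ξ)).congr fun n => ?_
    exact DFunLike.congr_fun (hT _ ((mem _).1 (hF n))) ξ

end SeqClosed

/-! ### Matrix entries of operators on `ℓ²(ι, H)` -/

section Entries

open scoped Classical in
/-- The matrix entry of an operator on `ℓ²(ι, H)`. -/
def entry {ι H : Type*} [NormedAddCommGroup H] [NormedSpace ℂ H]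
    (x : lp (fun _ : ι => H) 2 →L[ℂ] lp (fun _ : ι => H) 2) (s t : ι) : H →L[ℂ] H :=
  lp.evalCLM ℂ (fun _ : ι => H) 2 s ∘L x ∘L lp.singleContinuousLinearMap ℂ (fun _ : ι => H) 2 t

open scoped Classical in
theorem entry_apply {ι H : Type*} [NormedAddCommGroup H] [NormedSpace ℂ H]
    (x : lp (fun _ : ι => H) 2 →L[ℂ] lp (fun _ : ι => H) 2) (s t : ι) (ξ : H) :
    entry x s t ξ = x (lp.single 2 t ξ) s := rfl

/-- Dominated convergence in `ℓ²(ι, H)`. -/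
theorem tendsto_lp_of_dominated {ι H : Type*} [NormedAddCommGroup H]
    {F : ℕ → lp (fun _ : ι => H) 2}
    {f b : lp (fun _ : ι => H) 2} (hb : ∀ n i, ‖F n i‖ ≤ ‖b i‖)
    (hlim : ∀ i, Tendsto (fun n => F n i) atTop (𝓝 (f i))) : Tendsto F atTop (𝓝 f) := by
  have hf : ∀ i, ‖f i‖ ≤ ‖b i‖ := fun i =>
    le_of_tendsto (hlim i).norm (.of_forall fun n => hb n i)
  have h2 : (0 : ℝ) < (2 : ℝ≥0∞).toReal := by norm_num
  have hsum : Summable fun i => 4 * ‖b i‖ ^ 2 := by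
    have := (lp.memℓp b).summable h2
    simp only [ENNReal.toReal_ofNat, Real.rpow_two] at this
    exact this.mul_left 4
  have key := tendsto_tsum_of_dominated_convergence (𝓕 := atTop)
    (f := fun n i => ‖F n i - f i‖ ^ 2) (g := fun _ => (0 : ℝ)) hsum
    (fun i => by
      have := ((hlim i).sub_const (f i)).norm.pow 2
      simpa using this)
    (.of_forall fun n i => by
      rw [Real.norm_of_nonneg (by positivity)]
      have := (norm_sub_le (F n i) (f i)).trans (add_le_add (hb n i) (hf i))
      calc _ ≤ (‖b i‖ + ‖b i‖) ^ 2 := by gcongr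
        _ = _ := by ring)
  rw [tsum_zero] at key
  rw [tendsto_iff_norm_sub_tendsto_zero]
  have e : ∀ n, ‖F n - f‖ = √(∑' i, ‖F n i - f i‖ ^ 2) := by
    intro n
    rw [lp.norm_eq_tsum_rpow h2, Real.sqrt_eq_rpow]
    simp
  simp only [e]
  have := (Real.continuous_sqrt.tendsto 0).comp key
  simpa [Function.comp_def] using this

section Normed

variable {ι H : Type*} [NormedAddCommGroup H] [NormedSpace ℂ H]
  {x y : lp (fun _ : ι => H) 2 →L[ℂ] lp (fun _ : ι => H) 2}

theorem hasSum_entry_apply (x : lp (fun _ : ι => H) 2 →L[ℂ] lp (fun _ : ι => H) 2) (s : ι)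
    (ξ : lp (fun _ : ι => H) 2) : HasSum (fun r => entry x s r (ξ r)) (x ξ s) := by
  classical
  have h := (lp.hasSum_single (by norm_num) ξ).mapL
    (lp.evalCLM ℂ (fun _ : ι => H) 2 s ∘L x)
  exact h

theorem ext_entry (h : ∀ s t, entry x s t = entry y s t) : x = y := by
  ext1 ξ
  ext s : 2
  refine (hasSum_entry_apply x s ξ).unique ?_
  simp only [h]
  exact hasSum_entry_apply y s ξ

theorem hasSum_entry_mul (x y : lp (fun _ : ι => H) 2 →L[ℂ] lp (fun _ : ι => H) 2) (s t : ι)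
    (ξ : H) : HasSum (fun r => entry x s r (entry y r t ξ)) (entry (x * y) s t ξ) := by
  classical
  exact hasSum_entry_apply x s (y (lp.single 2 t ξ))

theorem entry_sum {κ : Type*} (F : Finset κ)
    (x : κ → lp (fun _ : ι => H) 2 →L[ℂ] lp (fun _ : ι => H) 2) (s t : ι) :
    entry (∑ i ∈ F, x i) s t = ∑ i ∈ F, entry (x i) s t := by
  simp [entry, ContinuousLinearMap.finsetSum_comp, ContinuousLinearMap.comp_finsetSum]

theorem diagOp_apply (T : ι → H →L[ℂ] H) (C : ℝ) (hT : ∀ i, ‖T i‖ ≤ C)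
    (ξ : lp (fun _ : ι => H) 2) (i : ι) : diagOp T C hT ξ i = T i (ξ i) := rfl

theorem entry_diagOp_mul (T : ι → H →L[ℂ] H) (C : ℝ) (hT : ∀ i, ‖T i‖ ≤ C)
    (x : lp (fun _ : ι => H) 2 →L[ℂ] lp (fun _ : ι => H) 2) (s t : ι) :
    entry (diagOp T C hT * x) s t = T s * entry x s t := rfl

open scoped Classical in
theorem diagOp_single (T : ι → H →L[ℂ] H) (C : ℝ) (hT : ∀ i, ‖T i‖ ≤ C) (t : ι) (ξ : H) :
    diagOp T C hT (lp.single 2 t ξ) = lp.single 2 t (T t ξ) := by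
  ext i : 2
  rw [diagOp_apply, lp.single_apply, lp.single_apply]
  by_cases h : i = t
  · subst h
    simp
  · simp [h]

theorem entry_mul_diagOp (T : ι → H →L[ℂ] H) (C : ℝ) (hT : ∀ i, ‖T i‖ ≤ C)
    (x : lp (fun _ : ι => H) 2 →L[ℂ] lp (fun _ : ι => H) 2) (s t : ι) :
    entry (x * diagOp T C hT) s t = entry x s t * T t := by
  classical
  ext1 ξ
  change x (diagOp T C hT (lp.single 2 t ξ)) s = _
  rw [diagOp_single]
  rfl

theorem reindexOp_apply (e : ι ≃ ι) (ξ : lp (fun _ : ι => H) 2) (i : ι) :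
    reindexOp e ξ i = ξ (e i) := rfl

theorem entry_reindexOp_mul (e : ι ≃ ι)
    (x : lp (fun _ : ι => H) 2 →L[ℂ] lp (fun _ : ι => H) 2) (s t : ι) :
    entry (reindexOp e * x) s t = entry x (e s) t := rfl

open scoped Classical in
theorem reindexOp_single (e : ι ≃ ι) (t : ι) (ξ : H) :
    reindexOp e (lp.single 2 t ξ) = lp.single 2 (e.symm t) ξ := by
  ext i : 2
  rw [reindexOp_apply, lp.single_apply, lp.single_apply]
  by_cases h : e i = t
  · subst h
    simp
  · have : i ≠ e.symm t := fun h' => h (by simp [h'])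
    simp [h, this]

theorem entry_mul_reindexOp (e : ι ≃ ι)
    (x : lp (fun _ : ι => H) 2 →L[ℂ] lp (fun _ : ι => H) 2) (s t : ι) :
    entry (x * reindexOp e) s t = entry x s (e.symm t) := by
  classical
  ext1 ξ
  change x (reindexOp e (lp.single 2 t ξ)) s = _
  rw [reindexOp_single]
  rfl

theorem diagOp_const_mul_reindexOp (e : ι ≃ ι) (T : H →L[ℂ] H) (C : ℝ) (hT : ι → ‖T‖ ≤ C) :
    diagOp (fun _ => T) C hT * reindexOp e = reindexOp e * diagOp (fun _ => T) C hT := by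
  ext1 ξ
  ext i : 2
  rfl

theorem entry_one (s t : ι) [Decidable (s = t)] :
    entry (1 : lp (fun _ : ι => H) 2 →L[ℂ] lp (fun _ : ι => H) 2) s t = if s = t then 1 else 0 := by
  classical
  ext1 ξ
  change (lp.single 2 t ξ : lp (fun _ : ι => H) 2) s = _
  rw [lp.single_apply]
  by_cases h : s = t
  · subst h
    simp
  · simp [h]

theorem entry_diagOp (T : ι → H →L[ℂ] H) (C : ℝ) (hT : ∀ i, ‖T i‖ ≤ C) (s t : ι)
    [Decidable (s = t)] : entry (diagOp T C hT) s t = if s = t then T s else 0 := by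
  rw [← mul_one (diagOp T C hT), entry_diagOp_mul, entry_one]
  split_ifs <;> simp

end Normed

section Hilbert

variable {ι H : Type*} [NormedAddCommGroup H] [InnerProductSpace ℂ H]

open scoped Classical in
theorem inner_entry (x : lp (fun _ : ι => H) 2 →L[ℂ] lp (fun _ : ι => H) 2) (s t : ι) (ξ η : H) :
    ⟪η, entry x s t ξ⟫_ℂ = ⟪lp.single 2 s η, x (lp.single 2 t ξ)⟫_ℂ := by
  rw [lp.inner_single_left, entry_apply]

variable [CompleteSpace H]

theorem entry_star (x : lp (fun _ : ι => H) 2 →L[ℂ] lp (fun _ : ι => H) 2) (s t : ι) :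
    entry (star x) s t = star (entry x t s) := by
  classical
  simp only [ContinuousLinearMap.star_eq_adjoint]
  rw [ContinuousLinearMap.eq_adjoint_iff]
  intro ξ η
  rw [inner_entry, ← inner_conj_symm, inner_entry, ContinuousLinearMap.adjoint_inner_right,
    inner_conj_symm]

theorem star_diagOp (T T' : ι → H →L[ℂ] H) (C C' : ℝ) (hT : ∀ i, ‖T i‖ ≤ C)
    (hT' : ∀ i, ‖T' i‖ ≤ C') (h : ∀ i, star (T i) = T' i) :
    star (diagOp T C hT) = diagOp T' C' hT' := by
  classical
  refine ext_entry fun s t => ?_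
  rw [entry_star, entry_diagOp, entry_diagOp]
  by_cases hst : s = t
  · subst hst
    simp [h]
  · simp [hst, Ne.symm hst]

theorem star_reindexOp (e : ι ≃ ι) :
    star (reindexOp e : lp (fun _ : ι => H) 2 →L[ℂ] _) = reindexOp e.symm := by
  classical
  refine ext_entry fun s t => ?_
  rw [entry_star, ← mul_one (reindexOp e), ← mul_one (reindexOp e.symm), entry_reindexOp_mul,
    entry_reindexOp_mul, entry_one, entry_one]
  by_cases h : e t = s
  · subst h
    simp
  · have : e.symm s ≠ t := fun h' => h (by simp [← h'])
    simp [h, this]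

end Hilbert

end Entries

/-! ### Translations and Koopman operators -/

section Koopman

variable {Y : Type uY} {Z : Type uZ} [MeasurableSpace Y] [MeasurableSpace Z]
  {ν : Measure Y} {ζ : Measure Z}

theorem pullback_ae (p : Y → Z) (hp : QuasiMeasurePreserving p ν ζ) (f : Lp ℂ ∞ ζ) :
    pullback p hp f =ᵐ[ν] f ∘ p :=
  MemLp.coeFn_toLp _

variable {Γ : Type uΓ} [Group Γ] [MulAction Γ Y] [NonsingularAction Γ ν]

theorem translate_ae (s : Γ) (f : Lp ℂ ∞ ν) : translate s f =ᵐ[ν] fun y => f (s⁻¹ • y) :=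
  pullback_ae _ _ f

variable (ν) in
theorem ae_smul (s : Γ) {P : Y → Prop} (h : ∀ᵐ y ∂ν, P y) : ∀ᵐ y ∂ν, P (s • y) :=
  (NonsingularAction.quasi (μ := ν) s).ae h

theorem norm_translate_le (s : Γ) (f : Lp ℂ ∞ ν) : ‖translate s f‖ ≤ ‖f‖ :=
  norm_pullback_le _ _ f

theorem translate_mul (s t : Γ) (f : Lp ℂ ∞ ν) :
    translate (s * t) f = translate s (translate t f) := by
  refine Lp.ext ?_
  filter_upwards [translate_ae (s * t) f, translate_ae s (translate t f),
    ae_smul ν s⁻¹ (translate_ae t f)] with y h₁ h₂ h₃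
  rw [h₁, h₂, h₃, mul_inv_rev, mul_smul]

theorem translate_one (f : Lp ℂ ∞ ν) : translate (1 : Γ) f = f := by
  refine Lp.ext ?_
  filter_upwards [translate_ae (1 : Γ) f] with y h₁
  rw [h₁, inv_one, one_smul]

/-- A bounded operator on `L²` implementing the action of `g` on `L^∞`. -/
theorem exists_koopman [IsFiniteMeasure ν] (g : Γ) : ∃ W : Lp ℂ 2 ν →L[ℂ] Lp ℂ 2 ν,
    (∀ m : Lp ℂ ∞ ν, W * mulOp m = mulOp (translate g m) * W) ∧
    ∀ᵐ y ∂ν, W (oneL2 ν) y ≠ 0 := by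
  set ρ := ν.map (fun y : Y => g • y) with hρ
  have hg : Measurable fun y : Y => g • y := (NonsingularAction.quasi (μ := ν) g).measurable
  have hg' : QuasiMeasurePreserving (fun y : Y => g⁻¹ • y) ν ν := NonsingularAction.quasi g⁻¹
  have hρν : ρ ≪ ν := (NonsingularAction.quasi (μ := ν) g).absolutelyContinuous
  have hνρ : ν ≪ ρ := by
    refine AbsolutelyContinuous.mk fun A hA h0 => ?_
    rw [hρ, Measure.map_apply hg hA] at h0
    have := hg'.preimage_null h0
    rwa [← Set.preimage_comp, show (fun y : Y => g • y) ∘ (fun y => g⁻¹ • y) = id from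
      funext fun y => smul_inv_smul g y, Set.preimage_id] at this
  -- The square root of the Radon–Nikodym derivative of the translated measure makes `ξ ↦ w · ξ (g⁻¹
  -- ·)` isometric. It vanishes almost nowhere because the translated measure is equivalent to `ν`.
  set w : Y → ℝ := fun y => √((ρ.rnDeriv ν y).toReal) with hw
  have hwm : Measurable w := (Measure.measurable_rnDeriv ρ ν).ennreal_toReal.sqrt
  have hwpos : ∀ᵐ y ∂ν, w y ≠ 0 := by
    have : IsFiniteMeasure ρ := by rw [hρ]; infer_instance
    filter_upwards [hνρ.ae_le (Measure.rnDeriv_pos hρν), Measure.rnDeriv_lt_top ρ ν] with y h₁ h₂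
    exact (Real.sqrt_pos.2 (ENNReal.toReal_pos h₁.ne' h₂.ne)).ne'
  have hmeas : ∀ ξ : Lp ℂ 2 ν, AEStronglyMeasurable (fun y => (w y : ℂ) * ξ (g⁻¹ • y)) ν :=
    fun ξ => (Complex.measurable_ofReal.comp hwm).aestronglyMeasurable.mul
      ((Lp.aestronglyMeasurable ξ).comp_quasiMeasurePreserving hg')
  have hnorm : ∀ ξ : Lp ℂ 2 ν, eLpNorm (fun y => (w y : ℂ) * ξ (g⁻¹ • y)) 2 ν = eLpNorm ξ 2 ν := by
    intro ξ
    have : IsFiniteMeasure ρ := by rw [hρ]; infer_instance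
    simp only [eLpNorm_eq_lintegral_rpow_enorm_toReal (p := 2) (by norm_num) (by norm_num),
      ENNReal.toReal_ofNat]
    congr 1
    have hm2 : AEMeasurable (fun y => ‖ξ (g⁻¹ • y)‖ₑ ^ (2 : ℝ)) ν :=
      (((Lp.aestronglyMeasurable ξ).comp_quasiMeasurePreserving hg').enorm).pow_const _
    calc _ = ∫⁻ y, ρ.rnDeriv ν y * ‖ξ (g⁻¹ • y)‖ₑ ^ (2 : ℝ) ∂ν := by
          refine lintegral_congr_ae ?_
          filter_upwards [Measure.rnDeriv_lt_top ρ ν] with y hy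
          rw [enorm_mul, ENNReal.mul_rpow_of_nonneg _ _ (by norm_num)]
          congr 1
          rw [← ofReal_norm, Complex.norm_real, Real.norm_of_nonneg (Real.sqrt_nonneg _),
            ENNReal.ofReal_rpow_of_nonneg (Real.sqrt_nonneg _) (by norm_num), Real.rpow_two,
            Real.sq_sqrt ENNReal.toReal_nonneg, ENNReal.ofReal_toReal hy.ne]
      _ = ∫⁻ y, ‖ξ (g⁻¹ • y)‖ₑ ^ (2 : ℝ) ∂ρ := lintegral_rnDeriv_mul hρν hm2
      _ = ∫⁻ y, ‖ξ (g⁻¹ • g • y)‖ₑ ^ (2 : ℝ) ∂ν := by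
          rw [hρ, lintegral_map' (hm2.mono_ac hρν) hg.aemeasurable]
      _ = _ := by simp
  have hmem : ∀ ξ : Lp ℂ 2 ν, MemLp (fun y => (w y : ℂ) * ξ (g⁻¹ • y)) 2 ν := fun ξ =>
    ⟨hmeas ξ, (hnorm ξ).trans_lt (Lp.eLpNorm_lt_top ξ)⟩
  let W : Lp ℂ 2 ν →L[ℂ] Lp ℂ 2 ν := LinearMap.mkContinuous
    { toFun := fun ξ => (hmem ξ).toLp _
      map_add' := fun ξ η => by
        refine Lp.ext ?_
        filter_upwards [(hmem (ξ + η)).coeFn_toLp, (hmem ξ).coeFn_toLp, (hmem η).coeFn_toLp,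
          Lp.coeFn_add ((hmem ξ).toLp _) ((hmem η).toLp _), hg'.ae (Lp.coeFn_add ξ η)]
          with y h₁ h₂ h₃ h₄ h₅
        rw [h₁, h₄, Pi.add_apply, h₂, h₃, h₅, Pi.add_apply, mul_add]
      map_smul' := fun c ξ => by
        refine Lp.ext ?_
        filter_upwards [(hmem (c • ξ)).coeFn_toLp, (hmem ξ).coeFn_toLp,
          Lp.coeFn_smul c ((hmem ξ).toLp _), hg'.ae (Lp.coeFn_smul c ξ)]
          with y h₁ h₂ h₃ h₄
        rw [RingHom.id_apply, h₁, h₃, Pi.smul_apply, h₂, h₄, Pi.smul_apply, smul_eq_mul,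
          smul_eq_mul]
        ring } 1 fun ξ => by
      change ‖(hmem ξ).toLp _‖ ≤ _
      rw [Lp.norm_toLp, hnorm, one_mul, Lp.norm_def]
  have hW : ∀ ξ, W ξ =ᵐ[ν] fun y => (w y : ℂ) * ξ (g⁻¹ • y) := fun ξ => (hmem ξ).coeFn_toLp
  refine ⟨W, fun m => ?_, ?_⟩
  · ext1 ξ
    change W (mulOp m ξ) = mulOp (translate g m) (W ξ)
    refine Lp.ext ?_
    filter_upwards [hW (mulOp m ξ), mulOp_ae (translate g m) (W ξ), hW ξ, translate_ae g m,
      hg'.ae (mulOp_ae m ξ)] with y h₁ h₂ h₃ h₄ h₅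
    rw [h₁, h₂, h₃, h₄, h₅]
    ring
  · filter_upwards [hW (oneL2 ν), hg'.ae (oneL2_ae (ν := ν)), hwpos] with y h₁ h₂ h₃
    rw [h₁, h₂, mul_one]
    exact_mod_cast h₃

end Koopman

/-! ### Elements of the crossed product -/

section CrossedEntries

variable {Γ : Type uΓ} [Group Γ] {Y : Type uY} [MeasurableSpace Y] {ν : Measure Y}

theorem entry_groupOp_mul (g : Γ) (x : RegularSpace Γ ν →L[ℂ] RegularSpace Γ ν) (s t : Γ) :
    entry (groupOp ν g * x) s t = entry x (g⁻¹ * s) t := rfl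

theorem entry_mul_groupOp (g : Γ) (x : RegularSpace Γ ν →L[ℂ] RegularSpace Γ ν) (s t : Γ) :
    entry (x * groupOp ν g) s t = entry x s (g * t) := by
  rw [groupOp, entry_mul_reindexOp]
  simp

theorem star_groupOp (g : Γ) : star (groupOp (Γ := Γ) ν g) = groupOp ν g⁻¹ := by
  rw [groupOp, star_reindexOp, groupOp]
  congr 1
  ext
  simp

theorem commute_groupOp_iff {T : RegularSpace Γ ν →L[ℂ] RegularSpace Γ ν} :
    (∀ g : Γ, groupOp ν g * T = T * groupOp ν g) ↔
      ∀ g s t : Γ, entry T (g * s) (g * t) = entry T s t := by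
  constructor
  · intro h g s t
    have := congrArg (fun x => entry x (g * s) t) (h g)
    simp only [entry_groupOp_mul, entry_mul_groupOp, inv_mul_cancel_left] at this
    exact this.symm
  · intro h g
    refine ext_entry fun s t => ?_
    rw [entry_groupOp_mul, entry_mul_groupOp, ← h g, mul_inv_cancel_left]

variable [MulAction Γ Y] [NonsingularAction Γ ν]

theorem entry_coeffOp_mul (f : Lp ℂ ∞ ν) (x : RegularSpace Γ ν →L[ℂ] RegularSpace Γ ν)
    (s t : Γ) : entry (coeffOp Γ f * x) s t = mulOp (translate s⁻¹ f) * entry x s t := rfl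

theorem entry_mul_coeffOp (f : Lp ℂ ∞ ν) (x : RegularSpace Γ ν →L[ℂ] RegularSpace Γ ν)
    (s t : Γ) : entry (x * coeffOp Γ f) s t = entry x s t * mulOp (translate t⁻¹ f) :=
  entry_mul_diagOp _ _ _ _ _ _

theorem entry_coeffOp (f : Lp ℂ ∞ ν) (s t : Γ) [Decidable (s = t)] :
    entry (coeffOp Γ f) s t = if s = t then mulOp (translate s⁻¹ f) else 0 :=
  entry_diagOp _ _ _ _ _

theorem star_coeffOp {f g : Lp ℂ ∞ ν} (h : g =ᵐ[ν] fun y => conj (f y)) :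
    star (coeffOp Γ f) = coeffOp Γ g := by
  refine star_diagOp _ _ _ _ _ _ fun t => star_mulOp ?_
  filter_upwards [translate_ae t⁻¹ f, translate_ae t⁻¹ g, ae_smul ν t⁻¹⁻¹ h] with y h₁ h₂ h₃
  rw [h₁, h₂, h₃]

theorem commute_coeffOp_iff {T : RegularSpace Γ ν →L[ℂ] RegularSpace Γ ν} {f : Lp ℂ ∞ ν} :
    coeffOp Γ f * T = T * coeffOp Γ f ↔ ∀ s t : Γ,
      mulOp (translate s⁻¹ f) * entry T s t = entry T s t * mulOp (translate t⁻¹ f) := by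
  simp only [← entry_coeffOp_mul, ← entry_mul_coeffOp]
  exact ⟨fun h s t => by rw [h], fun h => ext_entry h⟩

variable {N : Set (Lp ℂ ∞ ν)}

/-- The adjoint conditions in the bicommutant are redundant, since the generators are closed under
adjoints: `N` under conjugation, the `u_g` under inversion. -/
theorem mem_crossedProduct_iff_commute (hN : IsSeqClosedAlgebra N)
    {x : RegularSpace Γ ν →L[ℂ] RegularSpace Γ ν} :
    x ∈ crossedProduct Γ N ↔ ∀ T : RegularSpace Γ ν →L[ℂ] RegularSpace Γ ν,
      (∀ g s t : Γ, entry T (g * s) (g * t) = entry T s t) →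
      (∀ f ∈ N, ∀ s t : Γ,
        mulOp (translate s⁻¹ f) * entry T s t = entry T s t * mulOp (translate t⁻¹ f)) →
      T * x = x * T := by
  rw [crossedProduct, mem_generated]
  refine forall_congr' fun T => ?_
  rw [← commute_groupOp_iff]
  simp only [← commute_coeffOp_iff]
  refine ⟨fun h h₁ h₂ => h ?_, fun h h' => h (fun g => ?_) fun f hf => ?_⟩
  · rintro _ (⟨f, hf, rfl⟩ | ⟨g, rfl⟩)
    · obtain ⟨k, hk⟩ := exists_linfty_conj f
      rw [star_coeffOp hk]
      exact ⟨h₂ f hf, h₂ k (hN.conj_mem f hf k hk)⟩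
    · rw [star_groupOp]
      exact ⟨h₁ g, h₁ g⁻¹⟩
  · exact (h' _ (.inr ⟨g, rfl⟩)).1
  · exact (h' _ (.inl ⟨f, hf, rfl⟩)).1

theorem mem_crossedProduct_of_entry (hN : IsSeqClosedAlgebra N)
    {x : RegularSpace Γ ν →L[ℂ] RegularSpace Γ ν} {c : Γ → Lp ℂ ∞ ν} (hc : ∀ g, c g ∈ N)
    (hx : ∀ s t : Γ, entry x s t = mulOp (translate s⁻¹ (c (s * t⁻¹)))) :
    x ∈ crossedProduct Γ N := by
  rw [mem_crossedProduct_iff_commute hN]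
  intro T hT₁ hT₂
  refine ext_entry fun s t => ?_
  ext1 ξ
  have h₁ := hasSum_entry_mul T x s t ξ
  have h₂ := hasSum_entry_mul x T s t ξ
  -- The substitution `r ↦ s r⁻¹ t` matches the two matrix products term by term: `T` is invariant
  -- under the diagonal left translation by `s r⁻¹`, and it intertwines the translates of `c (s
  -- r⁻¹)`.
  let e : Γ ≃ Γ := (Equiv.inv Γ).trans ((Equiv.mulLeft s).trans (Equiv.mulRight t))
  rw [← e.hasSum_iff] at h₁
  refine h₁.unique (h₂.congr_fun ?_)
  intro r
  have he : e r = s * r⁻¹ * t := rfl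
  simp only [Function.comp_apply, he]
  rw [hx, hx]
  have h₃ := DFunLike.congr_fun (hT₂ (c (s * r⁻¹)) (hc _) s (s * r⁻¹ * t)) ξ
  have h₄ : entry T s (s * r⁻¹ * t) = entry T r t := by
    rw [← hT₁ (s * r⁻¹) r t]
    simp
  rw [h₄] at h₃ ⊢
  rw [show s * r⁻¹ * t * t⁻¹ = s * r⁻¹ by group]
  exact h₃.symm

/-- Two kinds of operators in the commutant of the crossed product suffice. Constant diagonals with
`T ∈ N'` force the entries into `N'' = N`; a Koopman operator combined with a right translation of
`Γ` relates the entries at `(s, t)` and `(s g, t g)`. -/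
theorem exists_entry_of_mem_crossedProduct [IsFiniteMeasure ν] (hN : IsSeqClosedAlgebra N)
    (hinv : ∀ s : Γ, ∀ f ∈ N, translate s f ∈ N)
    {x : RegularSpace Γ ν →L[ℂ] RegularSpace Γ ν} (hx : x ∈ crossedProduct Γ N) :
    ∃ c : Γ → Lp ℂ ∞ ν, (∀ g, c g ∈ N) ∧
      ∀ s t : Γ, entry x s t = mulOp (translate s⁻¹ (c (s * t⁻¹))) := by
  classical
  rw [mem_crossedProduct_iff_commute hN] at hx
  have hmem : ∀ s t, entry x s t ∈ mulOp '' N := by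
    intro s t
    rw [← hN.coe_generated, SetLike.mem_coe, mem_generated]
    intro T hT
    have := hx (diagOp (fun _ => T) ‖T‖ fun _ => le_rfl) (fun g s t => ?_) fun f hf s t => ?_
    · have := congrArg (fun x => entry x s t) this
      simpa only [entry_diagOp_mul, entry_mul_diagOp] using this
    · simp [entry_diagOp]
    · rw [entry_diagOp]
      split_ifs with hst
      · subst hst
        exact (hT _ ⟨_, hinv _ f hf, rfl⟩).1
      · simp
  choose c hcN hc using hmem
  have hcov : ∀ g s t, c s t = translate g (c (s * g) (t * g)) := by
    intro g s t
    obtain ⟨W, hW, hW0⟩ := exists_koopman (ν := ν) g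
    set R : RegularSpace Γ ν →L[ℂ] RegularSpace Γ ν :=
      diagOp (fun _ => W) ‖W‖ (fun _ => le_rfl) * reindexOp (Equiv.mulRight g) with hR
    have hRe : ∀ s t, entry R s t = if s * g = t then W else 0 := by
      intro s t
      rw [hR, entry_diagOp_mul, ← mul_one (reindexOp _), entry_reindexOp_mul, entry_one]
      change W * (if s * g = t then 1 else 0) = _
      split_ifs <;> simp
    have hRx := hx R (fun h s t => ?_) fun f hf s t => ?_
    · have h₁ : entry (R * x) s (t * g) = W * entry x (s * g) (t * g) := by
        rw [hR, mul_assoc, entry_diagOp_mul, entry_reindexOp_mul, Equiv.coe_mulRight]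
      have h₂ : entry (x * R) s (t * g) = entry x s t * W := by
        rw [hR, diagOp_const_mul_reindexOp, ← mul_assoc, entry_mul_diagOp, entry_mul_reindexOp]
        simp
      rw [hRx, h₂, ← hc, ← hc, hW] at h₁
      -- `W` need not be shown invertible: evaluating at `1` suffices, as `W 1` is a.e. nonzero and
      -- can be cancelled.
      have h₄ := DFunLike.congr_fun h₁ (oneL2 ν)
      change mulOp (c s t) (W (oneL2 ν)) = mulOp _ (W (oneL2 ν)) at h₄
      refine Lp.ext ?_
      filter_upwards [mulOp_ae (c s t) (W (oneL2 ν)), hW0,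
        mulOp_ae (translate g (c (s * g) (t * g))) (W (oneL2 ν))] with y e₁ e₂ e₃
      rw [h₄, e₃] at e₁
      exact (mul_right_cancel₀ e₂ e₁).symm
    · simp [hRe, mul_assoc]
    · rw [hRe]
      split_ifs with hst
      · rw [hW, ← translate_mul, ← hst]
        congr 3
        group
      · simp
  -- Covariance with `s⁻¹` moves the entry at `(s, t)` to `(1, t s⁻¹)`, and `t s⁻¹ = (s t⁻¹)⁻¹`.
  refine ⟨fun g => c 1 g⁻¹, fun g => hcN _ _, fun s t => ?_⟩
  rw [← hc, hcov s⁻¹ s t]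
  simp

end CrossedEntries

/-! ### Intermediate algebras of the crossed product -/

section Compression

/-- With a Borel injection `v : X → [0, 1]` and `φ k = ⌊k v⌋`, two points lie in different cells as
soon as `k |v x - v x'| ≥ 1`. The partitions need not be nested. -/
theorem exists_separating_seq (X : Type*) [MeasurableSpace X] [StandardBorelSpace X] :
    ∃ φ : ℕ → X → ℕ, (∀ k, Measurable (φ k)) ∧ (∀ k x, φ k x ≤ k) ∧
      ∀ x x', x ≠ x' → ∀ᶠ k in atTop, φ k x ≠ φ k x' := by
  have hv := measurableEmbedding_sigmoid_comp_embeddingReal X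
  set v : X → ℝ := fun x => (unitInterval.sigmoid ∘ embeddingReal X) x with hvdef
  have hvm : Measurable v := measurable_subtype_coe.comp hv.measurable
  have hvi : Function.Injective v := Subtype.val_injective.comp hv.injective
  have hv1 : ∀ x, v x ≤ 1 := fun x => unitInterval.le_one _
  have hv0 : ∀ x, 0 ≤ v x := fun x => unitInterval.nonneg _
  refine ⟨fun k x => ⌊(k : ℝ) * v x⌋₊, fun k => (hvm.const_mul _).nat_floor, fun k x => ?_, ?_⟩
  · refine Nat.floor_le_of_le ?_
    nlinarith [hv1 x, (Nat.cast_nonneg k : (0 : ℝ) ≤ k)]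
  · intro x x' hne
    have hpos : 0 < |v x - v x'| := abs_pos.2 (sub_ne_zero.2 (hvi.ne hne))
    have := (tendsto_natCast_atTop_atTop (R := ℝ)).atTop_mul_const hpos
    filter_upwards [this.eventually_ge_atTop 1] with k hk heq
    have h₁ := Nat.floor_le (mul_nonneg (Nat.cast_nonneg k) (hv0 x))
    have h₂ := Nat.lt_floor_add_one ((k : ℝ) * v x)
    have h₃ := Nat.floor_le (mul_nonneg (Nat.cast_nonneg k) (hv0 x'))
    have h₄ := Nat.lt_floor_add_one ((k : ℝ) * v x')
    rw [heq] at h₁ h₂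
    have : |(k : ℝ) * v x - k * v x'| < 1 := by
      rw [abs_lt]
      constructor <;> linarith
    rw [← mul_sub, abs_mul, Nat.abs_cast] at this
    linarith

variable {Γ : Type uΓ} [Group Γ] {Y : Type uY} [MeasurableSpace Y] {ν : Measure Y}
  [MulAction Γ Y] [NonsingularAction Γ ν]

/-- The block-diagonal compression of `x` by a finite family of functions. -/
def compression {κ : Type*} (F : Finset κ) (P : κ → Lp ℂ ∞ ν)
    (x : RegularSpace Γ ν →L[ℂ] RegularSpace Γ ν) : RegularSpace Γ ν →L[ℂ] RegularSpace Γ ν :=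
  ∑ i ∈ F, coeffOp Γ (P i) * x * coeffOp Γ (P i)

theorem compression_mem {κ : Type*} {F : Finset κ} {P : κ → Lp ℂ ∞ ν}
    {Q : VonNeumannAlgebra (RegularSpace Γ ν)} (hP : ∀ i, coeffOp Γ (P i) ∈ Q)
    {x : RegularSpace Γ ν →L[ℂ] RegularSpace Γ ν} (hx : x ∈ Q) : compression F P x ∈ Q :=
  sum_mem fun i _ => mul_mem (mul_mem (hP i) hx) (hP i)

theorem star_compression {κ : Type*} {F : Finset κ} {P : κ → Lp ℂ ∞ ν}
    (hP : ∀ i, P i =ᵐ[ν] fun y => conj (P i y))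
    (x : RegularSpace Γ ν →L[ℂ] RegularSpace Γ ν) :
    star (compression F P x) = compression F P (star x) := by
  simp only [compression, star_sum, star_mul, star_coeffOp (hP _), mul_assoc]

/-- At coordinate `s`, `P i` acts as the indicator of `{φ (s y) = i}`. Entries that are
multiplications commute with these indicators, so the sum over `i` keeps the points where `s y` and
`t y` share a cell. The `k + 1` summands exhaust the values `0, …, k` of `φ`. -/
theorem entry_compression_ae {φ : Y → ℕ} {k : ℕ} (hφ : ∀ y, φ y ≤ k) {P : ℕ → Lp ℂ ∞ ν}
    (hP : ∀ i, P i =ᵐ[ν] fun y => if φ y = i then (1 : ℂ) else 0)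
    {x : RegularSpace Γ ν →L[ℂ] RegularSpace Γ ν} {s t : Γ} {c : Lp ℂ ∞ ν}
    (hx : entry x s t = mulOp c) (ξ : Lp ℂ 2 ν) :
    entry (compression (Finset.range (k + 1)) P x) s t ξ =ᵐ[ν]
      fun y => if φ (s • y) = φ (t • y) then entry x s t ξ y else 0 := by
  have h₀ : entry (compression (Finset.range (k + 1)) P x) s t ξ =
      ∑ i ∈ Finset.range (k + 1),
        mulOp (translate s⁻¹ (P i)) (mulOp c (mulOp (translate t⁻¹ (P i)) ξ)) := by
    rw [compression, entry_sum, _root_.sum_apply]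
    refine Finset.sum_congr rfl fun i _ => ?_
    rw [entry_mul_coeffOp, entry_coeffOp_mul, hx]
    rfl
  have h₁ : ∀ i, mulOp (translate s⁻¹ (P i)) (mulOp c (mulOp (translate t⁻¹ (P i)) ξ)) =ᵐ[ν]
      fun y => (if φ (s • y) = i then 1 else 0) *
        (c y * ((if φ (t • y) = i then 1 else 0) * ξ y)) := by
    intro i
    filter_upwards [mulOp_ae (translate s⁻¹ (P i)) (mulOp c (mulOp (translate t⁻¹ (P i)) ξ)),
      mulOp_ae c (mulOp (translate t⁻¹ (P i)) ξ), mulOp_ae (translate t⁻¹ (P i)) ξ,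
      translate_ae s⁻¹ (P i), translate_ae t⁻¹ (P i), ae_smul ν s (hP i), ae_smul ν t (hP i)]
      with y e₁ e₂ e₃ e₄ e₅ e₆ e₇
    rw [e₁, e₂, e₃, e₄, e₅, inv_inv, inv_inv, e₆, e₇]
  rw [h₀, hx]
  filter_upwards [Lp.coeFn_finsetSum (Finset.range (k + 1)) fun i =>
      mulOp (translate s⁻¹ (P i)) (mulOp c (mulOp (translate t⁻¹ (P i)) ξ)),
    ae_all_iff.2 h₁, mulOp_ae c ξ] with y e₁ e₂ e₃
  rw [e₁, Finset.sum_apply, Finset.sum_congr rfl fun i _ => e₂ i,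
    Finset.sum_eq_single (φ (s • y))]
  · rw [e₃]
    by_cases h : φ (s • y) = φ (t • y)
    · simp [h]
    · simp [h, Ne.symm h]
  · intro i _ hi
    simp [hi.symm]
  · intro h
    exact absurd (Finset.mem_range.2 (Nat.lt_succ_of_le (hφ (s • y)))) h

open scoped Classical in
-- Diagonal entries are untouched and off-diagonal ones are eventually zero at almost every point;
-- dominated convergence, in `L²` and then in `ℓ²`, gives the limit on vectors supported at one
-- coordinate, without any uniform bound on the compressions.
theorem tendsto_compression {φ : ℕ → Y → ℕ} (hφ : ∀ k y, φ k y ≤ k)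
    (hsep : ∀ s t : Γ, s ≠ t → ∀ᵐ y ∂ν, ∀ᶠ k in atTop, φ k (s • y) ≠ φ k (t • y))
    {P : ℕ → ℕ → Lp ℂ ∞ ν}
    (hP : ∀ k i, P k i =ᵐ[ν] fun y => if φ k y = i then (1 : ℂ) else 0)
    {x D : RegularSpace Γ ν →L[ℂ] RegularSpace Γ ν}
    (hx : ∀ s t, ∃ c : Lp ℂ ∞ ν, entry x s t = mulOp c)
    (hD : ∀ s t, entry D s t = if s = t then entry x s t else 0) (t : Γ) (ξ : Lp ℂ 2 ν) :
    Tendsto (fun k => compression (Finset.range (k + 1)) (P k) x (lp.single 2 t ξ)) atTop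
      (𝓝 (D (lp.single 2 t ξ))) := by
  have hae : ∀ k s, entry (compression (Finset.range (k + 1)) (P k) x) s t ξ =ᵐ[ν]
      fun y => if φ k (s • y) = φ k (t • y) then entry x s t ξ y else 0 := by
    intro k s
    obtain ⟨c, hc⟩ := hx s t
    exact entry_compression_ae (hφ k) (hP k) hc ξ
  have hle : ∀ k s, ∀ᵐ y ∂ν, ‖entry (compression (Finset.range (k + 1)) (P k) x) s t ξ y‖ ≤
      ‖entry x s t ξ y‖ := by
    intro k s
    filter_upwards [hae k s] with y h
    rw [h]
    split_ifs <;> simp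
  refine tendsto_lp_of_dominated (b := x (lp.single 2 t ξ))
    (fun k s => Lp.norm_le_norm_of_ae_le (hle k s)) fun s => ?_
  change Tendsto (fun k => entry (compression (Finset.range (k + 1)) (P k) x) s t ξ) atTop
    (𝓝 (entry D s t ξ))
  rw [hD]
  refine tendsto_L2_of_dominated (b := entry x s t ξ) (C := 1)
    (fun k => by simpa using hle k s) ?_
  split_ifs with hst
  · subst hst
    filter_upwards [ae_all_iff.2 fun k => hae k s] with y h
    simp [h]
  · filter_upwards [ae_all_iff.2 fun k => hae k s, hsep s t hst, Lp.coeFn_zero ℂ 2 ν]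
      with y h₁ h₂ h₃
    change Tendsto _ _ (𝓝 ((0 : Lp ℂ 2 ν) y))
    rw [h₃]
    refine tendsto_const_nhds.congr' ?_
    filter_upwards [h₂] with k hk
    simp [h₁, hk]

end Compression

/-! ### The diagonal expectation preserves intermediate algebras -/

section Expectation

variable {Γ : Type uΓ} [Group Γ] {X : Type uX} [MeasurableSpace X] {Y : Type uY}
  [MeasurableSpace Y] {μ : Measure X} {ν : Measure Y} [MulAction Γ X] [MulAction Γ Y]

theorem isSeqClosedAlgebra_univ : IsSeqClosedAlgebra (Set.univ : Set (Lp ℂ ∞ ν)) := by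
  constructor <;> intros <;> trivial

theorem ae_smul_ne (hX : EssentiallyFree Γ μ) {π : Y → X} (hπ : IsFactorMap Γ ν μ π) {s t : Γ}
    (hst : s ≠ t) : ∀ᵐ y ∂ν, π (s • y) ≠ π (t • y) := by
  have h₀ : ∀ᵐ x ∂μ, (s⁻¹ * t) • x ≠ x :=
    measure_eq_zero_iff_ae_notMem.1 (hX (s⁻¹ * t) fun h => hst (inv_mul_eq_one.1 h))
  filter_upwards [hπ.ae_comp h₀, hπ.equivariant s, hπ.equivariant t] with y h₁ h₂ h₃ h₄
  rw [h₂, h₃] at h₄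
  exact h₁ (by rw [mul_smul, ← h₄, inv_smul_smul])

variable [StandardBorelSpace X] [IsFiniteMeasure μ] [IsFiniteMeasure ν] [NonsingularAction Γ ν]

/-- The conditional expectation onto `L^∞(Y)` preserves every intermediate von Neumann algebra. -/
theorem coeffOp_mem_of_entry_eq (hX : EssentiallyFree Γ μ) {π : Y → X}
    (hπ : IsFactorMap Γ ν μ π) {Q : VonNeumannAlgebra (RegularSpace Γ ν)}
    (hQ₀ : crossedProduct Γ (Set.range (pullback π hπ.quasi)) ≤ Q)
    (hQ₁ : Q ≤ crossedProduct Γ (Set.univ : Set (Lp ℂ ∞ ν)))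
    {x : RegularSpace Γ ν →L[ℂ] RegularSpace Γ ν} (hx : x ∈ Q) {f : Lp ℂ ∞ ν}
    (hf : entry x 1 1 = mulOp f) : coeffOp Γ f ∈ Q := by
  classical
  obtain ⟨φ, hφm, hφk, hφs⟩ := exists_separating_seq X
  have hA : ∀ k i, MeasurableSet {z | φ k z = i} := fun k i =>
    hφm k (measurableSet_singleton i)
  set P : ℕ → ℕ → Lp ℂ ∞ ν := fun k i =>
    pullback π hπ.quasi (indicatorConstLp ∞ (hA k i) (measure_ne_top μ _) 1) with hPdef
  have hP : ∀ k i, P k i =ᵐ[ν] fun y => if φ k (π y) = i then (1 : ℂ) else 0 := by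
    intro k i
    filter_upwards [pullback_ae π hπ.quasi (indicatorConstLp ∞ (hA k i) (measure_ne_top μ _) 1),
      hπ.quasi.ae (indicatorConstLp_coeFn (p := ∞) (hs := hA k i) (hμs := measure_ne_top μ _)
        (c := (1 : ℂ)))] with y h₁ h₂
    rw [hPdef, h₁, Function.comp_apply, h₂, Set.indicator_apply]
    rfl
  have hPr : ∀ k i, P k i =ᵐ[ν] fun y => conj (P k i y) := by
    intro k i
    filter_upwards [hP k i] with y h
    rw [h]
    split_ifs <;> simp
  have hPQ : ∀ k i, coeffOp Γ (P k i) ∈ Q := fun k i =>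
    hQ₀ (subset_generated _ (.inl ⟨_, ⟨_, rfl⟩, rfl⟩))
  have hsep : ∀ s t : Γ, s ≠ t →
      ∀ᵐ y ∂ν, ∀ᶠ k in atTop, φ k (π (s • y)) ≠ φ k (π (t • y)) := by
    intro s t hst
    filter_upwards [ae_smul_ne hX hπ hst] with y hy
    exact hφs _ _ hy
  have hmul : ∀ z ∈ Q, ∃ c : Γ → Lp ℂ ∞ ν, ∀ s t : Γ,
      entry z s t = mulOp (translate s⁻¹ (c (s * t⁻¹))) := fun z hz =>
    (exists_entry_of_mem_crossedProduct isSeqClosedAlgebra_univ (fun _ _ _ => trivial)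
      (hQ₁ hz)).imp fun c hc => hc.2
  have hDx : ∀ s t, entry (coeffOp Γ f) s t = if s = t then entry x s t else 0 := by
    intro s t
    rw [entry_coeffOp]
    split_ifs with hst
    · subst hst
      obtain ⟨c, hc⟩ := hmul x hx
      have h₁ := hc 1 1
      rw [hf, inv_one, translate_one, mul_one] at h₁
      rw [hc s s, mul_inv_cancel, mulOp_injective h₁]
    · rfl
  -- The adjoint needs its own limit: convergence is known only on vectors supported at one
  -- coordinate, and `T` does not preserve these. The commutation with `T` is therefore tested on
  -- matrix coefficients, with the compression moved to the left vector.
  have hDx' : ∀ s t, entry (star (coeffOp Γ f)) s t = if s = t then entry (star x) s t else 0 := by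
    intro s t
    rw [entry_star, entry_star, hDx]
    by_cases hst : s = t
    · subst hst
      simp
    · simp [hst, Ne.symm hst]
  have hlim := tendsto_compression (fun k y => hφk k (π y)) hsep hP
    (fun s t => (hmul x hx).elim fun c hc => ⟨_, hc s t⟩) hDx
  have hlim' := tendsto_compression (fun k y => hφk k (π y)) hsep hP
    (fun s t => (hmul _ (star_mem hx)).elim fun c hc => ⟨_, hc s t⟩) hDx'
  rw [mem_vonNeumannAlgebra_iff]
  intro T hT
  refine ext_entry fun s t => ?_
  ext1 ξ
  refine ext_inner_left ℂ fun η => ?_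
  rw [inner_entry, inner_entry]
  have h₁ : Tendsto (fun k => ⟪lp.single 2 s η,
      T (compression (Finset.range (k + 1)) (P k) x (lp.single 2 t ξ))⟫_ℂ) atTop
      (𝓝 ⟪lp.single 2 s η, T (coeffOp Γ f (lp.single 2 t ξ))⟫_ℂ) :=
    tendsto_const_nhds.inner ((T.continuous.tendsto _).comp (hlim t ξ))
  have h₂ : Tendsto (fun k => ⟪compression (Finset.range (k + 1)) (P k) (star x)
      (lp.single 2 s η), T (lp.single 2 t ξ)⟫_ℂ) atTop
      (𝓝 ⟪star (coeffOp Γ f) (lp.single 2 s η), T (lp.single 2 t ξ)⟫_ℂ) :=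
    (hlim' s η).inner tendsto_const_nhds
  rw [ContinuousLinearMap.star_eq_adjoint (coeffOp Γ f),
    ContinuousLinearMap.adjoint_inner_left] at h₂
  refine tendsto_nhds_unique h₁ (h₂.congr fun k => ?_)
  rw [← star_compression (hPr k), ContinuousLinearMap.star_eq_adjoint,
    ContinuousLinearMap.adjoint_inner_left]
  congr 1
  exact DFunLike.congr_fun (hT _ (compression_mem (hPQ k) hx)) _

end Expectation

/-! ### Functions whose copy lies in a given von Neumann algebra -/

section FromCrossed

variable {Γ : Type uΓ} [Group Γ] {Y : Type uY} [MeasurableSpace Y] {ν : Measure Y}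
  [MulAction Γ Y] [NonsingularAction Γ ν]

theorem translate_ae_smul (t : Γ) (f : Lp ℂ ∞ ν) :
    translate t⁻¹ f =ᵐ[ν] fun y => f (t • y) := by
  simpa only [inv_inv] using translate_ae t⁻¹ f

theorem groupOp_mul_coeffOp_mul_groupOp (s : Γ) (f : Lp ℂ ∞ ν) :
    groupOp ν s * coeffOp Γ f * groupOp ν s⁻¹ = coeffOp Γ (translate s f) := by
  classical
  refine ext_entry fun a b => ?_
  rw [entry_mul_groupOp, entry_groupOp_mul, entry_coeffOp, entry_coeffOp, ← translate_mul]
  simp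

/-- The functions whose canonical copy lies in a given von Neumann algebra form a sequentially
closed algebra. -/
theorem isSeqClosedAlgebra_coeffOp_mem (Q : VonNeumannAlgebra (RegularSpace Γ ν)) :
    IsSeqClosedAlgebra {f : Lp ℂ ∞ ν | coeffOp Γ f ∈ Q} := by
  classical
  refine ⟨fun h hh => ?_, fun f hf g hg => ?_, fun c f hf => ?_, fun f hf g hg h hh => ?_,
    fun f hf h hh => ?_, fun F f C hF hC hlim => ?_⟩
  · have : coeffOp Γ h = 1 := by
      refine ext_entry fun s t => ?_
      rw [entry_coeffOp, entry_one]
      split_ifs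
      · refine mulOp_one ?_
        filter_upwards [translate_ae_smul s h, ae_smul ν s hh] with y h₁ h₂
        rw [h₁, h₂]
      · rfl
    exact (this ▸ one_mem Q : coeffOp Γ h ∈ Q)
  · have : coeffOp Γ (f + g) = coeffOp Γ f + coeffOp Γ g := by
      ext1 ξ
      ext t : 2
      change mulOp (translate t⁻¹ (f + g)) (ξ t) =
        mulOp (translate t⁻¹ f) (ξ t) + mulOp (translate t⁻¹ g) (ξ t)
      rw [← _root_.add_apply, ← mulOp_add]
      congr 2
      refine Lp.ext ?_
      filter_upwards [translate_ae_smul t (f + g), translate_ae_smul t f, translate_ae_smul t g,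
        Lp.coeFn_add (translate t⁻¹ f) (translate t⁻¹ g), ae_smul ν t (Lp.coeFn_add f g)]
        with y h₁ h₂ h₃ h₄ h₅
      rw [h₁, h₄, Pi.add_apply, h₂, h₃, h₅, Pi.add_apply]
    exact (this ▸ add_mem hf hg : coeffOp Γ (f + g) ∈ Q)
  · have : coeffOp Γ (c • f) = c • coeffOp Γ f := by
      ext1 ξ
      ext t : 2
      change mulOp (translate t⁻¹ (c • f)) (ξ t) = c • mulOp (translate t⁻¹ f) (ξ t)
      rw [← _root_.smul_apply, ← mulOp_smul]
      congr 2
      refine Lp.ext ?_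
      filter_upwards [translate_ae_smul t (c • f), translate_ae_smul t f,
        Lp.coeFn_smul c (translate t⁻¹ f), ae_smul ν t (Lp.coeFn_smul c f)] with y h₁ h₂ h₃ h₄
      rw [h₁, h₃, Pi.smul_apply, h₂, h₄, Pi.smul_apply]
    exact (this ▸ smul_mem_vonNeumannAlgebra c hf : coeffOp Γ (c • f) ∈ Q)
  · have : coeffOp Γ h = coeffOp Γ f * coeffOp Γ g := by
      ext1 ξ
      ext t : 2
      change mulOp (translate t⁻¹ h) (ξ t) =
        (mulOp (translate t⁻¹ f) * mulOp (translate t⁻¹ g)) (ξ t)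
      rw [mulOp_mul]
      filter_upwards [translate_ae_smul t h, translate_ae_smul t f, translate_ae_smul t g,
        ae_smul ν t hh] with y h₁ h₂ h₃ h₄
      rw [h₁, h₂, h₃, h₄]
    exact (this ▸ mul_mem hf hg : coeffOp Γ h ∈ Q)
  · exact (star_coeffOp (Γ := Γ) hh ▸ star_mem hf : coeffOp Γ h ∈ Q)
  · refine mem_vonNeumannAlgebra_iff.2 fun T hT => Eq.symm ?_
    rw [commute_coeffOp_iff]
    intro s t
    have hl : ∀ (r : Γ) (ξ : Lp ℂ 2 ν), Tendsto (fun n => mulOp (translate r⁻¹ (F n)) ξ) atTop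
        (𝓝 (mulOp (translate r⁻¹ f) ξ)) := by
      intro r ξ
      refine tendsto_mulOp (fun n => (norm_translate_le _ _).trans (hC n)) ?_ ξ
      filter_upwards [ae_smul ν r hlim, translate_ae_smul r f,
        ae_all_iff.2 fun n => translate_ae_smul r (F n)] with y h₁ h₂ h₃
      simpa only [h₂, h₃] using h₁
    ext1 ξ
    refine tendsto_nhds_unique (hl s (entry T s t ξ))
      ((((entry T s t).continuous.tendsto _).comp (hl t ξ)).congr fun n => ?_)
    exact (DFunLike.congr_fun (commute_coeffOp_iff.1 (hT _ (hF n)) s t) ξ).symm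

end FromCrossed

/-! ### Algebras of functions factoring through a map -/

section Factor

variable {Γ : Type uΓ} [Group Γ] {Y : Type uY} {Z : Type uZ} [MeasurableSpace Y]
  [MeasurableSpace Z] [MulAction Γ Y] [MulAction Γ Z] {ν : Measure Y} {ζ : Measure Z} {p : Y → Z}

theorem measurableSet_eq_of_standardBorel {X : Type*} [MeasurableSpace X] [StandardBorelSpace X]
    {f g : Z → X} (hf : Measurable f) (hg : Measurable g) : MeasurableSet {z | f z = g z} := by
  let := upgradeStandardBorel X
  exact measurableSet_eq_fun hf hg

theorem IsFactorMap.ae_of_ae_comp (hp : IsFactorMap Γ ν ζ p) {P : Z → Prop}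
    (hP : MeasurableSet {z | P z}) (h : ∀ᵐ y ∂ν, P (p y)) : ∀ᵐ z ∂ζ, P z :=
  hp.absolutelyContinuous.ae_le ((ae_map_iff hp.quasi.aemeasurable hP).2 h)

/-- Lets `L^∞(Z)` be handled through genuine Borel functions on `Z`. No bound on `G` is required:
the one on `f` descends because `ζ ≪ ν.map p`. -/
theorem IsFactorMap.mem_range_pullback_iff (hp : IsFactorMap Γ ν ζ p) {f : Lp ℂ ∞ ν} :
    f ∈ Set.range (pullback p hp.quasi) ↔ ∃ G : Z → ℂ, Measurable G ∧ f =ᵐ[ν] G ∘ p := by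
  constructor
  · rintro ⟨g, rfl⟩
    obtain ⟨G, hG, hgG⟩ := Lp.aestronglyMeasurable g
    refine ⟨G, hG.measurable, ?_⟩
    filter_upwards [pullback_ae p hp.quasi g, hp.ae_comp hgG] with y h₁ h₂
    rw [h₁, Function.comp_apply, h₂, Function.comp_apply]
  · rintro ⟨G, hG, hfG⟩
    have hb : ∀ᵐ z ∂ζ, ‖G z‖ ≤ ‖f‖ := by
      refine hp.ae_of_ae_comp (measurableSet_le hG.norm measurable_const) ?_
      filter_upwards [hfG, ae_norm_le_norm f] with y h₁ h₂
      rwa [h₁] at h₂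
    obtain ⟨g, hg⟩ := exists_linfty_eq hG.aestronglyMeasurable hb
    refine ⟨g, Lp.ext ?_⟩
    filter_upwards [pullback_ae p hp.quasi g, hp.ae_comp hg, hfG] with y h₁ h₂ h₃
    rw [h₁, h₃, Function.comp_apply, h₂, Function.comp_apply]

theorem IsFactorMap.isSeqClosedAlgebra_range (hp : IsFactorMap Γ ν ζ p) :
    IsSeqClosedAlgebra (Set.range (pullback p hp.quasi)) := by
  refine ⟨fun h hh => ?_, fun f hf g hg => ?_, fun c f hf => ?_, fun f hf g hg h hh => ?_,
    fun f hf h hh => ?_, fun F f C hF hC hlim => ?_⟩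
  · exact hp.mem_range_pullback_iff.2 ⟨fun _ => 1, measurable_const, hh⟩
  · rw [hp.mem_range_pullback_iff] at *
    obtain ⟨F, hF, hfF⟩ := hf
    obtain ⟨G, hG, hgG⟩ := hg
    exact ⟨F + G, hF.add hG, (Lp.coeFn_add f g).trans (hfF.add hgG)⟩
  · rw [hp.mem_range_pullback_iff] at *
    obtain ⟨F, hF, hfF⟩ := hf
    exact ⟨c • F, hF.const_smul c, (Lp.coeFn_smul c f).trans (hfF.const_smul c)⟩
  · rw [hp.mem_range_pullback_iff] at *
    obtain ⟨F, hF, hfF⟩ := hf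
    obtain ⟨G, hG, hgG⟩ := hg
    exact ⟨F * G, hF.mul hG, hh.trans (hfF.mul hgG)⟩
  · rw [hp.mem_range_pullback_iff] at *
    obtain ⟨F, hF, hfF⟩ := hf
    refine ⟨fun z => conj (F z), Complex.continuous_conj.measurable.comp hF, ?_⟩
    filter_upwards [hh, hfF] with y h₁ h₂
    rw [h₁, h₂]
    rfl
  · choose G hG hFG using fun n => hp.mem_range_pullback_iff.1 (hF n)
    -- `limUnder` is measurable on all of `Z`, whatever its values where the sequence diverges; the
    -- limit is only needed at almost every `p y`.
    refine hp.mem_range_pullback_iff.2 ⟨fun z => limUnder atTop fun n => G n z,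
      (StronglyMeasurable.limUnder fun n => (hG n).stronglyMeasurable).measurable, ?_⟩
    filter_upwards [hlim, ae_all_iff.2 hFG] with y h₁ h₂
    simp only [h₂] at h₁
    exact h₁.limUnder_eq.symm

theorem IsFactorMap.translate_mem_range [NonsingularAction Γ ν] [NonsingularAction Γ ζ]
    (hp : IsFactorMap Γ ν ζ p) (s : Γ) {f : Lp ℂ ∞ ν}
    (hf : f ∈ Set.range (pullback p hp.quasi)) :
    translate s f ∈ Set.range (pullback p hp.quasi) := by
  rw [hp.mem_range_pullback_iff] at *
  obtain ⟨F, hF, hfF⟩ := hf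
  refine ⟨fun z => F (s⁻¹ • z),
    hF.comp (NonsingularAction.quasi (μ := ζ) s⁻¹).measurable, ?_⟩
  filter_upwards [translate_ae s f, ae_smul ν s⁻¹ hfF, hp.equivariant s⁻¹] with y h₁ h₂ h₃
  rw [h₁, h₂, Function.comp_apply, h₃, Function.comp_apply]

variable {Z' : Type*} [MeasurableSpace Z'] [StandardBorelSpace Z'] [MulAction Γ Z']
  {ζ' : Measure Z'} {p' : Y → Z'}

/-- A measurable map with values in a standard Borel space is recovered from the algebra of
functions factoring through it. -/
theorem IsFactorMap.exists_comp_eq [Nonempty Z'] [NonsingularAction Γ ν] [NonsingularAction Γ ζ]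
    [NonsingularAction Γ ζ'] (hp : IsFactorMap Γ ν ζ p) (hp' : IsFactorMap Γ ν ζ' p')
    (hle : Set.range (pullback p' hp'.quasi) ⊆ Set.range (pullback p hp.quasi)) :
    ∃ h : Z → Z', IsFactorMap Γ ζ ζ' h ∧ ∀ᵐ y ∂ν, h (p y) = p' y := by
  -- A bounded Borel embedding of `Z'` in `ℂ`. Since `e ∘ p'` belongs to the algebra of `p`, it
  -- equals some `G ∘ p` a.e.; a Borel left inverse `r` of `e` then gives the map `r ∘ G`.
  set e : Z' → ℂ := fun z => (((unitInterval.sigmoid ∘ embeddingReal Z') z : ℝ) : ℂ)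
  have he : MeasurableEmbedding e :=
    Complex.isometry_ofReal.isClosedEmbedding.measurableEmbedding.comp
      ((MeasurableEmbedding.subtype_coe measurableSet_Icc).comp
        (measurableEmbedding_sigmoid_comp_embeddingReal Z'))
  have heb : ∀ z, ‖e z‖ ≤ 1 := by
    intro z
    rw [Complex.norm_real, Real.norm_of_nonneg (unitInterval.nonneg _)]
    exact unitInterval.le_one _
  obtain ⟨f, hf⟩ := exists_linfty_eq (ν := ζ') he.measurable.aestronglyMeasurable (.of_forall heb)
  obtain ⟨G, hG, hfG⟩ := hp.mem_range_pullback_iff.1 (hle ⟨f, rfl⟩)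
  obtain ⟨r, hr, hre⟩ := he.exists_measurable_extend measurable_id fun _ => inferInstance
  have hcomp : ∀ᵐ y ∂ν, r (G (p y)) = p' y := by
    filter_upwards [hfG, pullback_ae p' hp'.quasi f, hp'.ae_comp hf] with y h₁ h₂ h₃
    rw [h₁, Function.comp_apply, Function.comp_apply, h₃] at h₂
    rw [h₂]
    exact congrFun hre (p' y)
  have hrG : Measurable (r ∘ G) := hr.comp hG
  refine ⟨r ∘ G, ⟨⟨hrG, ?_⟩, ?_, fun s => ?_⟩, hcomp⟩
  · refine AbsolutelyContinuous.mk fun A hA h0 => ?_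
    rw [Measure.map_apply hrG hA]
    refine measure_eq_zero_iff_ae_notMem.2 (hp.ae_of_ae_comp (hrG hA).compl ?_)
    filter_upwards [hcomp, hp'.ae_comp (measure_eq_zero_iff_ae_notMem.1 h0)] with y h₁ h₂
    rwa [Set.mem_preimage, Function.comp_apply, h₁]
  · refine AbsolutelyContinuous.mk fun A hA h0 => ?_
    rw [Measure.map_apply hrG hA] at h0
    refine measure_eq_zero_iff_ae_notMem.2 (hp'.ae_of_ae_comp hA.compl ?_)
    filter_upwards [hcomp, hp.ae_comp (measure_eq_zero_iff_ae_notMem.1 h0)] with y h₁ h₂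
    rwa [Set.mem_preimage, Function.comp_apply, h₁] at h₂
  · refine hp.ae_of_ae_comp (measurableSet_eq_of_standardBorel
      (hrG.comp (NonsingularAction.quasi (μ := ζ) s).measurable)
      ((NonsingularAction.quasi (μ := ζ') s).measurable.comp hrG)) ?_
    filter_upwards [hcomp, ae_smul ν s hcomp, hp.equivariant s, hp'.equivariant s]
      with y h₁ h₂ h₃ h₄
    rw [← h₃, Function.comp_apply, Function.comp_apply, h₁, h₂, h₄]

end Factor

/-! ### The σ-algebra of a sequentially closed algebra -/

section SigmaAlgebra

variable {Y : Type uY} [MeasurableSpace Y] {ν : Measure Y} {N : Set (Lp ℂ ∞ ν)}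

/-- Membership of (the class of) a function in a subset of `L^∞`. -/
def ClassMem (N : Set (Lp ℂ ∞ ν)) (g : Y → ℂ) : Prop := ∃ f ∈ N, f =ᵐ[ν] g

namespace IsSeqClosedAlgebra

theorem const (hN : IsSeqClosedAlgebra N) (c : ℂ) : ClassMem N fun _ => c := by
  obtain ⟨e, he⟩ := exists_linfty_eq (ν := ν) (h := fun _ => (1 : ℂ)) (C := 1)
    aestronglyMeasurable_const (by simp)
  refine ⟨c • e, hN.smul_mem c e (hN.one_mem e he), ?_⟩
  filter_upwards [Lp.coeFn_smul c e, he] with y h₁ h₂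
  simp [h₁, h₂]

theorem add (hN : IsSeqClosedAlgebra N) {a b : Y → ℂ} (ha : ClassMem N a) (hb : ClassMem N b) :
    ClassMem N fun y => a y + b y := by
  obtain ⟨f, hf, hfa⟩ := ha
  obtain ⟨g, hg, hgb⟩ := hb
  exact ⟨f + g, hN.add_mem f hf g hg, (Lp.coeFn_add f g).trans (hfa.add hgb)⟩

theorem mul (hN : IsSeqClosedAlgebra N) {a b : Y → ℂ} (ha : ClassMem N a) (hb : ClassMem N b) :
    ClassMem N fun y => a y * b y := by
  obtain ⟨f, hf, hfa⟩ := ha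
  obtain ⟨g, hg, hgb⟩ := hb
  obtain ⟨h, hh⟩ := exists_linfty_mul f g
  exact ⟨h, hN.mul_mem f hf g hg h hh, hh.trans (hfa.mul hgb)⟩

theorem lim (hN : IsSeqClosedAlgebra N) {a : ℕ → Y → ℂ} {b : Y → ℂ} {C : ℝ}
    (ha : ∀ n, ClassMem N (a n)) (hC : ∀ n, ∀ᵐ y ∂ν, ‖a n y‖ ≤ C)
    (hlim : ∀ᵐ y ∂ν, Tendsto (fun n => a n y) atTop (𝓝 (b y))) : ClassMem N b := by
  choose F hFN hF using ha
  have hF' : ∀ᵐ y ∂ν, Tendsto (fun n => F n y) atTop (𝓝 (b y)) := by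
    filter_upwards [hlim, ae_all_iff.2 hF] with y h₁ h₂
    simpa only [h₂] using h₁
  obtain ⟨f, hf⟩ := exists_linfty_eq (h := b) (C := C)
    (aestronglyMeasurable_of_tendsto_ae atTop (fun n => Lp.aestronglyMeasurable (F n)) hF') (by
      filter_upwards [hlim, ae_all_iff.2 hC] with y h₁ h₂
      exact le_of_tendsto h₁.norm (.of_forall h₂))
  refine ⟨f, hN.lim_mem F f (max C 0) hFN (fun n => ?_) ?_, hf⟩
  · refine norm_le_of_ae_bound_top (le_max_right _ _) ?_
    filter_upwards [hF n, hC n] with y h₁ h₂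
    rw [h₁]
    exact h₂.trans (le_max_left _ _)
  · filter_upwards [hF', hf] with y h₁ h₂
    rwa [h₂]

theorem compl (hN : IsSeqClosedAlgebra N) {A : Set Y} (hA : ClassMem N (A.indicator 1)) :
    ClassMem N (Aᶜ.indicator 1) := by
  convert hN.add (hN.const 1) (hN.mul (hN.const (-1)) hA) using 2 with y
  by_cases hy : y ∈ A <;> simp [hy]

theorem union (hN : IsSeqClosedAlgebra N) {A B : Set Y} (hA : ClassMem N (A.indicator 1))
    (hB : ClassMem N (B.indicator 1)) : ClassMem N ((A ∪ B).indicator 1) := by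
  convert hN.add hA (hN.mul hB (hN.compl hA)) using 2 with y
  by_cases hy : y ∈ A <;> by_cases hy' : y ∈ B <;> simp [hy, hy']

theorem iUnion (hN : IsSeqClosedAlgebra N) {A : ℕ → Set Y}
    (hA : ∀ n, ClassMem N ((A n).indicator 1)) : ClassMem N ((⋃ n, A n).indicator 1) := by
  have hB : ∀ n, ClassMem N ((⋃ i ∈ Finset.range n, A i).indicator 1) := by
    intro n
    induction n with
    | zero =>
      convert hN.const 0 using 2 with y
      simp
    | succ n ih =>
      rw [Finset.range_add_one, Finset.set_biUnion_insert]
      exact hN.union (hA n) ih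
  refine hN.lim (C := 1) hB (fun n => .of_forall fun y => ?_) (.of_forall fun y => ?_)
  · by_cases hy : y ∈ ⋃ i ∈ Finset.range n, A i
    · rw [Set.indicator_of_mem hy]
      simp
    · rw [Set.indicator_of_notMem hy]
      simp
  · exact ((tendsto_indicator_biUnion_finset A (1 : Y → ℂ) y).comp tendsto_finset_range).mono_right
      (pure_le_nhds _)

/-- The σ-algebra of sets whose indicator function belongs to the algebra. -/
@[reducible] def sigmaAlgebra (hN : IsSeqClosedAlgebra N) : MeasurableSpace Y where
  MeasurableSet' A := ClassMem N (A.indicator 1)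
  measurableSet_empty := by
    convert hN.const 0 using 2 with y
    simp
  measurableSet_compl _ := hN.compl
  measurableSet_iUnion _ := hN.iUnion

/-- The indicator of a closed set is a bounded pointwise limit of continuous functions, so by
functional calculus preimages of closed sets have their indicators in `N`. -/
theorem measurable_sigmaAlgebra (hN : IsSeqClosedAlgebra N) {b : Y → ℂ} (hb : ClassMem N b) :
    Measurable[hN.sigmaAlgebra] b := by
  obtain ⟨f, hf, hfb⟩ := hb
  refine @measurable_of_isClosed _ _ _ _ _ hN.sigmaAlgebra _ fun C hC => ?_
  change ClassMem N ((b ⁻¹' C).indicator 1)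
  have hδ : ∀ n : ℕ, (0 : ℝ) < 1 / ((n : ℝ) + 1) := fun n => by positivity
  have ht := thickenedIndicator_tendsto_indicator_closure hδ
    tendsto_one_div_add_atTop_nhds_zero_nat C
  rw [hC.closure_eq, tendsto_pi_nhds] at ht
  have hcont : ∀ n, Continuous fun z : ℂ => ((thickenedIndicator (hδ n) C z : ℝ) : ℂ) := fun n =>
    Complex.continuous_ofReal.comp
      (NNReal.continuous_coe.comp (thickenedIndicator (hδ n) C).continuous)
  have hbd : ∀ n z, ‖((thickenedIndicator (hδ n) C z : ℝ) : ℂ)‖ ≤ 1 := by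
    intro n z
    rw [Complex.norm_real, Real.norm_of_nonneg (NNReal.coe_nonneg _)]
    exact_mod_cast thickenedIndicator_le_one (hδ n) C z
  refine hN.lim (C := 1) (a := fun n y => ((thickenedIndicator (hδ n) C (b y) : ℝ) : ℂ))
    (fun n => ?_) (fun n => .of_forall fun y => hbd n _) (.of_forall fun y => ?_)
  · obtain ⟨g, hg⟩ := exists_linfty_eq (ν := ν) (C := 1)
      ((hcont n).comp_aestronglyMeasurable (Lp.aestronglyMeasurable f))
      (.of_forall fun y => hbd n _)
    refine ⟨g, hN.mem_of_eq_comp hf (hcont n) hg, ?_⟩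
    filter_upwards [hg, hfb] with y h₁ h₂
    rw [h₁, h₂]
  · have h := ((Complex.continuous_ofReal.comp NNReal.continuous_coe).tendsto _).comp (ht (b y))
    have e : (b ⁻¹' C).indicator 1 y = (Complex.ofReal ∘ NNReal.toReal)
        (C.indicator (fun _ => 1) (b y)) := by
      by_cases hy : b y ∈ C
      · rw [Set.indicator_of_mem (show y ∈ b ⁻¹' C from hy)]
        simp [hy]
      · rw [Set.indicator_of_notMem (show y ∉ b ⁻¹' C from hy)]
        simp [hy]
    rw [e]
    exact h

theorem mem_of_measurable (hN : IsSeqClosedAlgebra N) {f : Lp ℂ ∞ ν} {b : Y → ℂ}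
    (hb : Measurable[hN.sigmaAlgebra] b) (hfb : f =ᵐ[ν] b) : f ∈ N := by
  have hs : ∀ s : @SimpleFunc Y hN.sigmaAlgebra ℂ, ClassMem N s := by
    intro s
    induction s using SimpleFunc.induction with
    | @const c A hA =>
      convert hN.mul (hN.const c) hA using 2 with y
      by_cases hy : y ∈ A <;> simp [hy]
    | add _ h₁ h₂ => exact hN.add h₁ h₂
  have hsm : StronglyMeasurable[hN.sigmaAlgebra] b := hb.stronglyMeasurable
  have hmem : ClassMem N b := by
    -- Approximants truncated at `‖f‖` are bounded everywhere, and converge wherever `|b| ≤ ‖f‖`,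
    -- that is almost everywhere.
    refine hN.lim (C := ‖f‖) (fun n => hs (hsm.approxBounded ‖f‖ n))
      (fun n => .of_forall fun y => hsm.norm_approxBounded_le (norm_nonneg _) n y) ?_
    filter_upwards [hfb, ae_norm_le_norm f] with y h₁ h₂
    exact hsm.tendsto_approxBounded_of_norm_le (h₁ ▸ h₂)
  obtain ⟨g, hg, hgb⟩ := hmem
  rwa [Lp.ext (hfb.trans hgb.symm)]

theorem inter {N' : Set (Lp ℂ ∞ ν)} (hN : IsSeqClosedAlgebra N) (hN' : IsSeqClosedAlgebra N') :
    IsSeqClosedAlgebra (N ∩ N') :=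
  ⟨fun h hh => ⟨hN.one_mem h hh, hN'.one_mem h hh⟩,
    fun f hf g hg => ⟨hN.add_mem f hf.1 g hg.1, hN'.add_mem f hf.2 g hg.2⟩,
    fun c f hf => ⟨hN.smul_mem c f hf.1, hN'.smul_mem c f hf.2⟩,
    fun f hf g hg h hh => ⟨hN.mul_mem f hf.1 g hg.1 h hh, hN'.mul_mem f hf.2 g hg.2 h hh⟩,
    fun f hf h hh => ⟨hN.conj_mem f hf.1 h hh, hN'.conj_mem f hf.2 h hh⟩,
    fun F f C hF hC hl => ⟨hN.lim_mem F f C (fun n => (hF n).1) hC hl,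
      hN'.lim_mem F f C (fun n => (hF n).2) hC hl⟩⟩

/-- Used to see that joins of invariant algebras are invariant. -/
theorem preimage_translate {Γ : Type uΓ} [Group Γ] [MulAction Γ Y] [NonsingularAction Γ ν]
    (hN : IsSeqClosedAlgebra N) (s : Γ) : IsSeqClosedAlgebra (translate s ⁻¹' N) := by
  refine ⟨fun h hh => hN.one_mem _ ?_, fun f hf g hg => ?_, fun c f hf => ?_,
    fun f hf g hg h hh => hN.mul_mem _ hf _ hg _ ?_, fun f hf h hh => hN.conj_mem _ hf _ ?_,
    fun F f C hF hC hlim => hN.lim_mem (fun n => translate s (F n)) _ C hF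
      (fun n => (norm_translate_le _ _).trans (hC n)) ?_⟩
  · filter_upwards [translate_ae s h, ae_smul ν s⁻¹ hh] with y h₁ h₂
    rw [h₁, h₂]
  · have : translate s (f + g) = translate s f + translate s g := by
      refine Lp.ext ?_
      filter_upwards [translate_ae s (f + g), translate_ae s f, translate_ae s g,
        Lp.coeFn_add (translate s f) (translate s g), ae_smul ν s⁻¹ (Lp.coeFn_add f g)]
        with y h₁ h₂ h₃ h₄ h₅
      rw [h₁, h₄, Pi.add_apply, h₂, h₃, h₅, Pi.add_apply]
    rw [Set.mem_preimage, this]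
    exact hN.add_mem _ hf _ hg
  · have : translate s (c • f) = c • translate s f := by
      refine Lp.ext ?_
      filter_upwards [translate_ae s (c • f), translate_ae s f,
        Lp.coeFn_smul c (translate s f), ae_smul ν s⁻¹ (Lp.coeFn_smul c f)] with y h₁ h₂ h₃ h₄
      rw [h₁, h₃, Pi.smul_apply, h₂, h₄, Pi.smul_apply]
    rw [Set.mem_preimage, this]
    exact hN.smul_mem c _ hf
  · filter_upwards [translate_ae s h, translate_ae s f, translate_ae s g, ae_smul ν s⁻¹ hh]
      with y h₁ h₂ h₃ h₄
    rw [h₁, h₂, h₃, h₄]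
  · filter_upwards [translate_ae s h, translate_ae s f, ae_smul ν s⁻¹ hh] with y h₁ h₂ h₃
    rw [h₁, h₂, h₃]
  · filter_upwards [ae_all_iff.2 fun n => translate_ae s (F n), translate_ae s f,
      ae_smul ν s⁻¹ hlim] with y h₁ h₂ h₃
    simpa only [h₁, h₂] using h₃

end IsSeqClosedAlgebra

end SigmaAlgebra

/-! ### Intermediate extensions and intermediate algebras -/

section Extensions

variable {Γ : Type uΓ} [Group Γ] {X : Type uX} {Y : Type uY}
  [MeasurableSpace X] [MeasurableSpace Y] [MulAction Γ Y] {μ : Measure X} {ν : Measure Y}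
  {π : Y → X}

theorem IntermediateAlgebra.isSeqClosedAlgebra [NonsingularAction Γ ν] [IsFiniteMeasure ν]
    {hπ : QuasiMeasurePreserving π ν μ} (N : IntermediateAlgebra Γ μ ν π hπ) :
    IsSeqClosedAlgebra N.carrier :=
  isSeqClosedAlgebra_iff.2 N.isVonNeumann

variable [MulAction Γ X]

namespace IntermediateExtension

theorem linfty_subset_of_equivalent {E E' : IntermediateExtension.{uΓ, uX, uY, w} Γ μ ν π}
    (h : Equivalent E E') : E'.linfty ⊆ E.linfty := by
  obtain ⟨h, k, hh, -, -, -, hp, -⟩ := h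
  rintro _ ⟨f, rfl⟩
  refine ⟨pullback h hh.quasi f, Lp.ext ?_⟩
  filter_upwards [pullback_ae E.p E.isFactorMap_p.quasi (pullback h hh.quasi f),
    E.isFactorMap_p.ae_comp (pullback_ae h hh.quasi f), pullback_ae E'.p E'.isFactorMap_p.quasi f,
    hp] with y h₁ h₂ h₃ h₄
  rw [h₁, Function.comp_apply, h₂, h₃, Function.comp_apply, Function.comp_apply, h₄]

variable [NonsingularAction Γ ν]

/-- The intermediate algebra `L^∞(Z)` of an intermediate extension. -/
def toAlgebra [IsFiniteMeasure ν] (hπ : QuasiMeasurePreserving π ν μ)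
    (E : IntermediateExtension.{uΓ, uX, uY, w} Γ μ ν π) : IntermediateAlgebra Γ μ ν π hπ where
  carrier := E.linfty
  isVonNeumann := isSeqClosedAlgebra_iff.1 E.isFactorMap_p.isSeqClosedAlgebra_range
  translate_mem s _ hf := E.isFactorMap_p.translate_mem_range s hf
  base_mem := by
    rintro _ ⟨f, rfl⟩
    refine ⟨pullback E.q E.isFactorMap_q.quasi f, Lp.ext ?_⟩
    filter_upwards [pullback_ae E.p E.isFactorMap_p.quasi (pullback E.q E.isFactorMap_q.quasi f),
      E.isFactorMap_p.ae_comp (pullback_ae E.q E.isFactorMap_q.quasi f), pullback_ae π hπ f,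
      E.comp_eq] with y h₁ h₂ h₃ h₄
    rw [h₁, Function.comp_apply, h₂, h₃, Function.comp_apply, Function.comp_apply, ← h₄,
      Function.comp_apply]

/-- The two inclusions give maps in both directions. That they are mutually inverse and lie over `X`
may be checked after composing with `p`, as null sets of `Z` are detected on `Y`. -/
theorem equivalent_of_linfty_eq [StandardBorelSpace X]
    {E E' : IntermediateExtension.{uΓ, uX, uY, w} Γ μ ν π}
    (h : E.linfty = E'.linfty) : Equivalent E E' := by
  have : Nonempty E.Z := nonempty_of_isProbabilityMeasure E.ζ
  have : Nonempty E'.Z := nonempty_of_isProbabilityMeasure E'.ζ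
  obtain ⟨a, ha, hap⟩ := E.isFactorMap_p.exists_comp_eq E'.isFactorMap_p h.ge
  obtain ⟨b, hb, hbp⟩ := E'.isFactorMap_p.exists_comp_eq E.isFactorMap_p h.le
  refine ⟨a, b, ha, hb, ?_, ?_, hap, ?_⟩
  · refine E.isFactorMap_p.ae_of_ae_comp (measurableSet_eq_of_standardBorel
      (hb.quasi.measurable.comp ha.quasi.measurable) measurable_id) ?_
    filter_upwards [hap, hbp] with y h₁ h₂
    simp only [h₁, h₂]
  · refine E'.isFactorMap_p.ae_of_ae_comp (measurableSet_eq_of_standardBorel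
      (ha.quasi.measurable.comp hb.quasi.measurable) measurable_id) ?_
    filter_upwards [hap, hbp] with y h₁ h₂
    simp only [h₁, h₂]
  · refine E.isFactorMap_p.ae_of_ae_comp (measurableSet_eq_of_standardBorel
      E.isFactorMap_q.quasi.measurable
      (E'.isFactorMap_q.quasi.measurable.comp ha.quasi.measurable)) ?_
    filter_upwards [hap, E.comp_eq, E'.comp_eq] with y h₁ h₂ h₃
    simp only [Function.comp_apply] at h₂ h₃ ⊢
    rw [h₁, h₂, h₃]

/-- An equivariant measurable map on `Y` over `X` with values in a standard Borel `Γ`-space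
defines an intermediate extension. -/
theorem exists_of_equivariant [StandardBorelSpace X] [IsProbabilityMeasure ν]
    [NonsingularAction Γ μ] (hπ : IsFactorMap Γ ν μ π) {Z : Type w} [MeasurableSpace Z]
    [StandardBorelSpace Z] [MulAction Γ Z] (hsmul : ∀ s : Γ, Measurable fun z : Z => s • z)
    {p : Y → Z} {q : Z → X} (hp : Measurable p) (hq : Measurable q)
    (hequiv : ∀ (s : Γ) y, p (s • y) = s • p y) (hqp : q ∘ p = π) :
    ∃ E : IntermediateExtension.{uΓ, uX, uY, w} Γ μ ν π,
      ∀ f : Lp ℂ ∞ ν, f ∈ E.linfty ↔ ∃ G : Z → ℂ, Measurable G ∧ f =ᵐ[ν] G ∘ p := by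
  have : IsProbabilityMeasure (ν.map p) := Measure.isProbabilityMeasure_map hp.aemeasurable
  have hpf : IsFactorMap Γ ν (ν.map p) p :=
    ⟨⟨hp, .rfl⟩, .rfl, fun s => .of_forall (hequiv s)⟩
  have hns : NonsingularAction Γ (ν.map p) := by
    refine ⟨fun s => ⟨hsmul s, AbsolutelyContinuous.mk fun A hA h0 => ?_⟩⟩
    rw [Measure.map_apply (hsmul s) hA]
    refine measure_eq_zero_iff_ae_notMem.2 (hpf.ae_of_ae_comp (hsmul s hA).compl ?_)
    filter_upwards [ae_smul ν s (hpf.ae_comp (measure_eq_zero_iff_ae_notMem.1 h0))] with y hy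
    rwa [Set.mem_preimage, ← hequiv]
  have hqf : IsFactorMap Γ (ν.map p) μ q := by
    have hmap : (ν.map p).map q = ν.map π := by rw [Measure.map_map hq hp, hqp]
    refine ⟨⟨hq, hmap ▸ hπ.quasi.absolutelyContinuous⟩, hmap ▸ hπ.absolutelyContinuous,
      fun s => ?_⟩
    refine hpf.ae_of_ae_comp (measurableSet_eq_of_standardBorel (hq.comp (hsmul s))
      ((NonsingularAction.quasi (μ := μ) s).measurable.comp hq)) ?_
    filter_upwards [hπ.equivariant s] with y hy
    rw [← hqp] at hy
    simpa only [Function.comp_apply, hequiv] using hy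
  exact ⟨⟨Z, ν.map p, p, q, hpf, hqf, .of_forall fun y => congrFun hqp y⟩,
    fun f => hpf.mem_range_pullback_iff⟩

/-- The previous construction, with values transported to a prescribed universe. -/
theorem exists_of_equivariant_of_not_countable [StandardBorelSpace X] [IsProbabilityMeasure ν]
    [NonsingularAction Γ μ] (hπ : IsFactorMap Γ ν μ π) {Z : Type uZ} [MeasurableSpace Z]
    [StandardBorelSpace Z] (hZ : ¬ Countable Z) [MulAction Γ Z]
    (hsmul : ∀ s : Γ, Measurable fun z : Z => s • z)
    {p : Y → Z} {q : Z → X} (hp : Measurable p) (hq : Measurable q)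
    (hequiv : ∀ (s : Γ) y, p (s • y) = s • p y) (hqp : q ∘ p = π) :
    ∃ E : IntermediateExtension.{uΓ, uX, uY, w} Γ μ ν π,
      ∀ f : Lp ℂ ∞ ν, f ∈ E.linfty ↔ ∃ G : Z → ℂ, Measurable G ∧ f =ᵐ[ν] G ∘ p := by
  have hR : ¬ Countable (ULift.{w} ℝ) := fun h =>
    not_countable (α := ℝ) ((Equiv.ulift.{w} (α := ℝ)).countable_iff.1 h)
  -- Uncountable standard Borel spaces are all Borel isomorphic, so the action can be carried to a
  -- copy of `ℝ` in the universe `w`.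
  let e : ULift.{w} ℝ ≃ᵐ Z := PolishSpace.measurableEquivOfNotCountable hR hZ
  let _ : MulAction Γ (ULift.{w} ℝ) := e.toEquiv.mulAction Γ
  have hact : ∀ (s : Γ) (z : ULift.{w} ℝ), s • z = e.symm (s • e z) := fun s z => rfl
  obtain ⟨E, hE⟩ := exists_of_equivariant (Z := ULift.{w} ℝ) hπ
    (fun s => (e.symm.measurable.comp ((hsmul s).comp e.measurable) : _))
    (p := e.symm ∘ p) (q := q ∘ e) (e.symm.measurable.comp hp) (hq.comp e.measurable)
    (fun s y => by simp [hact, hequiv]) (by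
      funext y
      simp [← hqp])
  refine ⟨E, fun f => (hE f).trans ⟨?_, ?_⟩⟩
  · rintro ⟨G, hG, hfG⟩
    exact ⟨G ∘ e.symm, hG.comp e.symm.measurable, hfG⟩
  · rintro ⟨G, hG, hfG⟩
    refine ⟨G ∘ e, hG.comp e.measurable, hfG.trans (.of_forall fun y => ?_)⟩
    simp

end IntermediateExtension

/-- The product `W^Γ`, on which `Γ` acts by left translation of the coordinates. -/
def Shift (Γ : Type uΓ) (W : Type uZ) : Type (max uΓ uZ) := Γ → W

instance {W : Type uZ} [MeasurableSpace W] : MeasurableSpace (Shift Γ W) :=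
  inferInstanceAs (MeasurableSpace (Γ → W))

instance {W : Type uZ} [Countable Γ] [MeasurableSpace W] [StandardBorelSpace W] :
    StandardBorelSpace (Shift Γ W) :=
  inferInstanceAs (StandardBorelSpace (Γ → W))

instance {W : Type uZ} : MulAction Γ (Shift Γ W) where
  smul s z := fun t => z (s⁻¹ * t)
  one_smul z := by
    funext t
    change z (1⁻¹ * t) = z t
    simp
  mul_smul s s' z := by
    funext t
    change z ((s * s')⁻¹ * t) = z (s'⁻¹ * (s⁻¹ * t))
    rw [mul_inv_rev, mul_assoc]

theorem Shift.measurable_smul {W : Type uZ} [MeasurableSpace W] (s : Γ) :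
    Measurable fun z : Shift Γ W => s • z :=
  measurable_pi_lambda _ fun t => measurable_pi_apply (s⁻¹ * t)

/-- Every intermediate algebra comes from an intermediate extension. -/
theorem IntermediateExtension.exists_linfty_eq_carrier [Countable Γ] [StandardBorelSpace X]
    [StandardBorelSpace Y] [IsProbabilityMeasure μ] [IsProbabilityMeasure ν]
    [NonsingularAction Γ μ] [NonsingularAction Γ ν] (hπ : IsFactorMap Γ ν μ π)
    (N : IntermediateAlgebra Γ μ ν π hπ.quasi) :
    ∃ E : IntermediateExtension.{uΓ, uX, uY, w} Γ μ ν π, E.linfty = N.carrier := by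
  have hN := N.isSeqClosedAlgebra
  have : Fact ((2 : ℝ≥0∞) ≠ ∞) := ⟨by norm_num⟩
  -- Separability of `L²(Y)` provides countably many elements of `N` that are `L²`-dense in it.
  obtain ⟨t, htN, htc, htd⟩ := (TopologicalSpace.IsSeparable.of_separableSpace
    ((fun g => mulOp g (oneL2 ν)) '' N.carrier)).exists_countable_dense_subset
  have hne : t.Nonempty := by
    obtain ⟨e, he, -⟩ := hN.const 1
    exact closure_nonempty_iff.1 ⟨_, htd ⟨e, he, rfl⟩⟩
  obtain ⟨u, rfl⟩ := htc.exists_eq_range hne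
  choose f hfN hfu using fun n => htN ⟨n, rfl⟩
  choose a ha hfa using fun n => Lp.aestronglyMeasurable (f n)
  have hsm : ∀ s : Γ, Measurable fun y : Y => s • y := fun s =>
    (NonsingularAction.quasi (μ := ν) s).measurable
  -- Recording the dense sequence and `π` along the whole orbit makes `p` equivariant at every
  -- point, not merely a.e.; the coordinate at `1` returns `π`.
  let p : Y → Shift Γ ((ℕ → ℂ) × X) := fun y s => (fun n => a n (s⁻¹ • y), π (s⁻¹ • y))
  have hp : Measurable p := measurable_pi_lambda _ fun s =>
    (measurable_pi_lambda _ fun n => (ha n).measurable.comp (hsm s⁻¹)).prodMk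
      (hπ.quasi.measurable.comp (hsm s⁻¹))
  have hpe : ∀ (s : Γ) y, p (s • y) = s • p y := by
    intro s y
    funext r
    change ((fun n => a n (r⁻¹ • s • y), π (r⁻¹ • s • y)) : (ℕ → ℂ) × X) =
      (fun n => a n ((s⁻¹ * r)⁻¹ • y), π ((s⁻¹ * r)⁻¹ • y))
    simp [mul_smul]
  have hnc : ¬ Countable (Shift Γ ((ℕ → ℂ) × X)) := by
    intro hc
    obtain ⟨x₀⟩ := nonempty_of_isProbabilityMeasure μ
    have hinj : Function.Injective
        (fun (c : ℝ) => (fun _ => (fun _ => (c : ℂ), x₀) : Shift Γ ((ℕ → ℂ) × X))) := by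
      intro c d h
      exact Complex.ofReal_injective (congrFun (congrArg Prod.fst (congrFun h 1)) 0)
    exact not_countable (α := ℝ) (@Function.Injective.countable _ _ hc _ hinj)
  obtain ⟨E, hE⟩ := IntermediateExtension.exists_of_equivariant_of_not_countable.{uΓ, uX, uY, _, w}
    hπ hnc Shift.measurable_smul (p := p) (q := fun z => (z 1).2) hp
    (measurable_snd.comp (measurable_pi_apply 1)) hpe (by
      funext y
      change π ((1 : Γ)⁻¹ • y) = π y
      simp)
  refine ⟨E, Set.Subset.antisymm (fun g hg => ?_) fun g hg => (hE g).2 ?_⟩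
  · obtain ⟨G, hG, hgG⟩ := (hE g).1 hg
    -- All coordinates of `p` are measurable for the σ-algebra of `N`, by invariance of `N` and
    -- because it contains `L^∞(X)`; hence bounded functions of `p` belong to `N`.
    have hpN : @Measurable _ _ hN.sigmaAlgebra _ p := by
      refine @measurable_pi_lambda _ _ _ hN.sigmaAlgebra _ _ fun s => ?_
      have h₁ : Measurable[hN.sigmaAlgebra] fun y n => a n (s⁻¹ • y) := by
        refine @measurable_pi_lambda Y ℕ (fun _ => ℂ) hN.sigmaAlgebra _ _ fun n => ?_
        refine hN.measurable_sigmaAlgebra ⟨translate s (f n), N.translate_mem s _ (hfN n), ?_⟩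
        filter_upwards [translate_ae s (f n), ae_smul ν s⁻¹ (hfa n)] with y h₁ h₂
        rw [h₁, h₂]
      have h₂ : Measurable[hN.sigmaAlgebra] fun y => π (s⁻¹ • y) := by
        intro B hB
        refine ⟨translate s (pullback π hπ.quasi (indicatorConstLp ∞ hB (measure_ne_top μ _) 1)),
          N.translate_mem s _ (N.base_mem ⟨_, rfl⟩), ?_⟩
        filter_upwards [translate_ae s (pullback π hπ.quasi
            (indicatorConstLp ∞ hB (measure_ne_top μ _) 1)),
          ae_smul ν s⁻¹ (pullback_ae π hπ.quasi (indicatorConstLp ∞ hB (measure_ne_top μ _) 1)),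
          ae_smul ν s⁻¹ (hπ.ae_comp (indicatorConstLp_coeFn (p := ∞) (hs := hB)
            (hμs := measure_ne_top μ _) (c := (1 : ℂ))))] with y h₁ h₂ h₃
        rw [h₁, h₂, Function.comp_apply, h₃]
        rfl
      exact h₁.prodMk h₂
    exact hN.mem_of_measurable (@Measurable.comp _ _ _ hN.sigmaAlgebra _ _ _ _ hG hpN) hgG
  -- Conversely, an element of `N` is an a.e. limit of a subsequence drawn from the dense sequence,
  -- and so a Borel function of the coordinate of `p` at `1`.
  · obtain ⟨v, hv, hvlim⟩ := mem_closure_iff_seq_limit.1 (htd ⟨g, hg, rfl⟩)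
    choose n hn using hv
    obtain ⟨ns, -, hns⟩ := (tendstoInMeasure_of_tendsto_Lp hvlim).exists_seq_tendsto_ae
    refine ⟨fun z => limUnder atTop fun k => (z 1).1 (n (ns k)),
      (StronglyMeasurable.limUnder fun k => Measurable.stronglyMeasurable
        ((measurable_pi_apply (n (ns k))).comp
          (measurable_fst.comp (measurable_pi_apply (1 : Γ))))).measurable, ?_⟩
    filter_upwards [hns, mulOp_one_ae g, ae_all_iff.2 fun k => mulOp_one_ae (f k),
      ae_all_iff.2 hfa] with y h₁ h₂ h₃ h₄
    have e : ∀ k, v (ns k) y = a (n (ns k)) y := fun k => by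
      rw [← hn, ← hfu, h₃, h₄]
    simp only [e, h₂] at h₁
    change g y = limUnder atTop fun k => a (n (ns k)) ((1 : Γ)⁻¹ • y)
    simp only [inv_one, one_smul]
    exact h₁.limUnder_eq.symm

end Extensions

/-! ### The lattice isomorphism -/

section Lattice

variable {Γ : Type uΓ} [Group Γ] {X : Type uX} {Y : Type uY}
  [MeasurableSpace X] [MeasurableSpace Y] [MulAction Γ Y]
  {μ : Measure X} {ν : Measure Y} [NonsingularAction Γ ν] {π : Y → X}

theorem crossedProduct_mono {N N' : Set (Lp ℂ ∞ ν)} (h : N ⊆ N') :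
    crossedProduct Γ N ≤ crossedProduct Γ N' :=
  generated_mono (Set.union_subset_union_left _ (Set.image_mono h))

theorem coeffOp_mem_crossedProduct {N : Set (Lp ℂ ∞ ν)} {f : Lp ℂ ∞ ν} (hf : f ∈ N) :
    coeffOp Γ f ∈ crossedProduct Γ N :=
  subset_generated _ (.inl ⟨f, hf, rfl⟩)

theorem groupOp_mem_crossedProduct (N : Set (Lp ℂ ∞ ν)) (g : Γ) :
    groupOp ν g ∈ crossedProduct Γ N :=
  subset_generated _ (.inr ⟨g, rfl⟩)

variable [IsFiniteMeasure ν]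

namespace IntermediateAlgebra

variable {hπ : QuasiMeasurePreserving π ν μ}

theorem mem_crossedProduct_iff (N : IntermediateAlgebra Γ μ ν π hπ)
    {x : RegularSpace Γ ν →L[ℂ] RegularSpace Γ ν} :
    x ∈ crossedProduct Γ N.carrier ↔ ∃ c : Γ → Lp ℂ ∞ ν, (∀ g, c g ∈ N.carrier) ∧
      ∀ s t : Γ, entry x s t = mulOp (translate s⁻¹ (c (s * t⁻¹))) :=
  ⟨exists_entry_of_mem_crossedProduct N.isSeqClosedAlgebra N.translate_mem,
    fun ⟨_, hc, hx⟩ => mem_crossedProduct_of_entry N.isSeqClosedAlgebra hc hx⟩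

theorem coeffOp_mem_crossedProduct_iff (N : IntermediateAlgebra Γ μ ν π hπ) {f : Lp ℂ ∞ ν} :
    coeffOp Γ f ∈ crossedProduct Γ N.carrier ↔ f ∈ N.carrier := by
  classical
  refine ⟨fun h => ?_, coeffOp_mem_crossedProduct⟩
  obtain ⟨c, hc, hx⟩ := N.mem_crossedProduct_iff.1 h
  have h₁ := hx 1 1
  rw [entry_coeffOp, if_pos rfl, inv_one, translate_one, translate_one] at h₁
  exact mulOp_injective h₁ ▸ hc _

theorem crossedProduct_le_iff (N N' : IntermediateAlgebra Γ μ ν π hπ) :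
    crossedProduct Γ N.carrier ≤ crossedProduct Γ N'.carrier ↔ N ≤ N' :=
  ⟨fun h _ hf => N'.coeffOp_mem_crossedProduct_iff.1 (h (coeffOp_mem_crossedProduct hf)),
    fun h => crossedProduct_mono h⟩

/-- The intersection of two intermediate algebras. -/
def inter (N N' : IntermediateAlgebra Γ μ ν π hπ) : IntermediateAlgebra Γ μ ν π hπ where
  carrier := N.carrier ∩ N'.carrier
  isVonNeumann := isSeqClosedAlgebra_iff.1 (N.isSeqClosedAlgebra.inter N'.isSeqClosedAlgebra)
  translate_mem s f hf := ⟨N.translate_mem s f hf.1, N'.translate_mem s f hf.2⟩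
  base_mem := Set.subset_inter N.base_mem N'.base_mem

/-- Coefficients are determined by the operator, so those obtained from `N` and from `N'` coincide.
-/
theorem mem_crossedProduct_inter_iff (N N' : IntermediateAlgebra Γ μ ν π hπ)
    {x : RegularSpace Γ ν →L[ℂ] RegularSpace Γ ν} :
    x ∈ crossedProduct Γ (N.inter N').carrier ↔
      x ∈ crossedProduct Γ N.carrier ∧ x ∈ crossedProduct Γ N'.carrier := by
  refine ⟨fun h => ⟨crossedProduct_mono Set.inter_subset_left h,
    crossedProduct_mono Set.inter_subset_right h⟩, ?_⟩
  rw [N.mem_crossedProduct_iff, N'.mem_crossedProduct_iff, mem_crossedProduct_iff]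
  rintro ⟨⟨c, hc, hx⟩, c', hc', hx'⟩
  refine ⟨c, fun g => ⟨hc g, ?_⟩, hx⟩
  have h₁ := (hx 1 g⁻¹).symm.trans (hx' 1 g⁻¹)
  simp only [inv_one, translate_one, one_mul, inv_inv] at h₁
  exact mulOp_injective h₁ ▸ hc' g

/-- The generated algebra stays inside the multiplication operators because `L^∞(Y)` is itself a von
Neumann algebra. For invariance, its preimage under a translation is again a von Neumann algebra and
contains both `N` and `N'`. -/
theorem exists_join (N N' : IntermediateAlgebra Γ μ ν π hπ) :
    ∃ M : IntermediateAlgebra Γ μ ν π hπ,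
      mulOp '' M.carrier = generated (mulOp '' N.carrier ∪ mulOp '' N'.carrier) := by
  set A := generated (mulOp '' N.carrier ∪ mulOp '' N'.carrier) with hA
  have himage : (A : Set _) = mulOp '' {f : Lp ℂ ∞ ν | mulOp f ∈ A} := by
    refine Set.Subset.antisymm (fun x hx => ?_) (by rintro _ ⟨f, hf, rfl⟩; exact hf)
    have h₁ : A ≤ generated (mulOp '' (Set.univ : Set (Lp ℂ ∞ ν))) := generated_mono
      (Set.union_subset (Set.image_mono (Set.subset_univ _)) (Set.image_mono (Set.subset_univ _)))
    have h₂ : x ∈ (generated (mulOp '' (Set.univ : Set (Lp ℂ ∞ ν))) : Set _) := h₁ hx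
    rw [isSeqClosedAlgebra_univ.coe_generated] at h₂
    obtain ⟨f, -, rfl⟩ := h₂
    exact ⟨f, hx, rfl⟩
  have hseq := isSeqClosedAlgebra_iff.2 ⟨A, himage⟩
  refine ⟨⟨{f | mulOp f ∈ A}, ⟨A, himage⟩, fun s f hf => ?_, fun f hf =>
    subset_generated _ (.inl ⟨f, N.base_mem hf, rfl⟩)⟩, himage.symm⟩
  have hM := hseq.preimage_translate s
  have hle : A ≤ generated (mulOp '' (translate s ⁻¹' {f : Lp ℂ ∞ ν | mulOp f ∈ A})) := by
    refine generated_mono (Set.union_subset (Set.image_mono fun g hg => ?_)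
      (Set.image_mono fun g hg => ?_))
    · exact subset_generated _ (.inl ⟨_, N.translate_mem s g hg, rfl⟩)
    · exact subset_generated _ (.inr ⟨_, N'.translate_mem s g hg, rfl⟩)
  have h₂ : mulOp f ∈ (generated (mulOp '' (translate s ⁻¹' {f : Lp ℂ ∞ ν | mulOp f ∈ A})) :
      Set _) := hle hf
  rw [hM.coe_generated, mulOp_injective.mem_set_image] at h₂
  exact h₂

/-- The functions whose copy lies in an intermediate algebra of the crossed product. -/
def ofCrossed (Q : VonNeumannAlgebra (RegularSpace Γ ν))
    (hQ : crossedProduct Γ (Set.range (pullback π hπ)) ≤ Q) : IntermediateAlgebra Γ μ ν π hπ where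
  carrier := {f | coeffOp Γ f ∈ Q}
  isVonNeumann := isSeqClosedAlgebra_iff.1 (isSeqClosedAlgebra_coeffOp_mem Q)
  translate_mem s f hf := by
    rw [Set.mem_ofPred_eq, ← groupOp_mul_coeffOp_mul_groupOp]
    exact mul_mem (mul_mem (hQ (groupOp_mem_crossedProduct _ s)) hf)
      (hQ (groupOp_mem_crossedProduct _ s⁻¹))
  base_mem _ hf := hQ (coeffOp_mem_crossedProduct hf)

end IntermediateAlgebra

variable [MulAction Γ X] [StandardBorelSpace X] [IsFiniteMeasure μ]

/-- The coefficient `c g` of `x` is the `(1, 1)` entry of `x u_g⁻¹`, which is again in `Q`; by the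
expectation argument its copy lies in `Q`. -/
theorem crossedProduct_ofCrossed (hX : EssentiallyFree Γ μ) (hπ : IsFactorMap Γ ν μ π)
    (Q : VonNeumannAlgebra (RegularSpace Γ ν))
    (hQ₀ : crossedProduct Γ (Set.range (pullback π hπ.quasi)) ≤ Q)
    (hQ₁ : Q ≤ crossedProduct Γ (Set.univ : Set (Lp ℂ ∞ ν))) :
    crossedProduct Γ (IntermediateAlgebra.ofCrossed Q hQ₀).carrier = Q := by
  refine le_antisymm (generated_le ?_) fun x hx => ?_
  · rintro _ (⟨f, hf, rfl⟩ | ⟨g, rfl⟩)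
    · exact hf
    · exact hQ₀ (groupOp_mem_crossedProduct _ g)
  · obtain ⟨c, -, hc⟩ := exists_entry_of_mem_crossedProduct isSeqClosedAlgebra_univ
      (fun _ _ _ => trivial) (hQ₁ hx)
    refine (IntermediateAlgebra.mem_crossedProduct_iff _).2 ⟨c, fun g => ?_, hc⟩
    refine coeffOp_mem_of_entry_eq hX hπ hQ₀ hQ₁
      (mul_mem hx (hQ₀ (groupOp_mem_crossedProduct _ g⁻¹))) ?_
    rw [entry_mul_groupOp, hc]
    simp [translate_one]

/-- The order isomorphism `N ↦ N ⋊ Γ`. -/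
def crossedProductOrderIso (hX : EssentiallyFree Γ μ) (hπ : IsFactorMap Γ ν μ π) :
    IntermediateAlgebra Γ μ ν π hπ.quasi ≃o
      Set.Icc (crossedProduct Γ (Set.range (pullback π hπ.quasi)))
        (crossedProduct Γ (Set.univ : Set (Lp ℂ ∞ ν))) where
  toFun N := ⟨crossedProduct Γ N.carrier, crossedProduct_mono N.base_mem,
    crossedProduct_mono (Set.subset_univ _)⟩
  invFun Q := .ofCrossed Q.1 Q.2.1
  left_inv N := IntermediateAlgebra.ext (Set.ext fun _ => N.coeffOp_mem_crossedProduct_iff)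
  right_inv Q := Subtype.ext (crossedProduct_ofCrossed hX hπ Q.1 Q.2.1 Q.2.2)
  map_rel_iff' {N N'} := N.crossedProduct_le_iff N'

/-- Writing the generated algebra `Q` as `M ⋊ Γ`, the algebra `M` contains `N₁` and `N₂`, hence the
von Neumann algebra `N` they generate; so `N ⋊ Γ ≤ Q`. The other inclusion is monotonicity. -/
theorem crossedProductOrderIso_join (hX : EssentiallyFree Γ μ) (hπ : IsFactorMap Γ ν μ π)
    {N₁ N₂ N : IntermediateAlgebra Γ μ ν π hπ.quasi}
    (hN : mulOp '' N.carrier = generated (mulOp '' N₁.carrier ∪ mulOp '' N₂.carrier)) :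
    crossedProduct Γ N.carrier = generated
      ({T | T ∈ crossedProduct Γ N₁.carrier} ∪ {T | T ∈ crossedProduct Γ N₂.carrier}) := by
  set Q := generated
    ({T | T ∈ crossedProduct Γ N₁.carrier} ∪ {T | T ∈ crossedProduct Γ N₂.carrier}) with hQ
  have h₁ : crossedProduct Γ N₁.carrier ≤ Q := fun x hx => subset_generated _ (.inl hx)
  have h₂ : crossedProduct Γ N₂.carrier ≤ Q := fun x hx => subset_generated _ (.inr hx)
  have hQ₀ := (crossedProduct_mono N₁.base_mem).trans h₁
  have hQ₁ : Q ≤ crossedProduct Γ (Set.univ : Set (Lp ℂ ∞ ν)) :=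
    generated_le (Set.union_subset (crossedProduct_mono (Set.subset_univ _))
      (crossedProduct_mono (Set.subset_univ _)))
  have hmem : ∀ f, f ∈ N.carrier ↔
      mulOp f ∈ generated (mulOp '' N₁.carrier ∪ mulOp '' N₂.carrier) := fun f => by
    rw [← SetLike.mem_coe, ← hN, mulOp_injective.mem_set_image]
  refine le_antisymm ?_ (generated_le (Set.union_subset ?_ ?_))
  · rw [← crossedProduct_ofCrossed hX hπ Q hQ₀ hQ₁]
    refine crossedProduct_mono fun f hf => ?_
    have hseq := (IntermediateAlgebra.ofCrossed Q hQ₀).isSeqClosedAlgebra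
    have hle : generated (mulOp '' N₁.carrier ∪ mulOp '' N₂.carrier) ≤
        generated (mulOp '' (IntermediateAlgebra.ofCrossed Q hQ₀).carrier) :=
      generated_mono (Set.union_subset
        (Set.image_mono fun g hg => h₁ (coeffOp_mem_crossedProduct hg))
        (Set.image_mono fun g hg => h₂ (coeffOp_mem_crossedProduct hg)))
    have h₃ : mulOp f ∈
        (generated (mulOp '' (IntermediateAlgebra.ofCrossed Q hQ₀).carrier) : Set _) :=
      hle ((hmem f).1 hf)
    rwa [hseq.coe_generated, mulOp_injective.mem_set_image] at h₃
  · exact crossedProduct_mono fun f hf => (hmem f).2 (subset_generated _ (.inl ⟨f, hf, rfl⟩))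
  · exact crossedProduct_mono fun f hf => (hmem f).2 (subset_generated _ (.inr ⟨f, hf, rfl⟩))

end Lattice

/-- Intermediate extensions up to equivalence correspond to intermediate algebras. -/
def extensionEquiv {Γ : Type uΓ} [Group Γ] [Countable Γ] {X : Type uX} [MeasurableSpace X]
    [StandardBorelSpace X] {Y : Type uY} [MeasurableSpace Y] [StandardBorelSpace Y]
    {μ : Measure X} [IsProbabilityMeasure μ] {ν : Measure Y} [IsProbabilityMeasure ν]
    [MulAction Γ X] [NonsingularAction Γ μ] [MulAction Γ Y] [NonsingularAction Γ ν] {π : Y → X}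
    (hπ : IsFactorMap Γ ν μ π) :
    ExtensionClass.{uΓ, uX, uY, w} Γ μ ν π ≃ IntermediateAlgebra Γ μ ν π hπ.quasi :=
  Equiv.ofBijective
    (Quotient.lift (IntermediateExtension.toAlgebra hπ.quasi) fun _ _ h =>
      IntermediateAlgebra.ext (Set.Subset.antisymm
        (IntermediateExtension.linfty_subset_of_equivalent
          (IntermediateExtension.equivalence_equivalent.symm h))
        (IntermediateExtension.linfty_subset_of_equivalent h))) <| by
    constructor
    · rintro ⟨E⟩ ⟨E'⟩ h
      exact Quotient.sound (IntermediateExtension.equivalent_of_linfty_eq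
        (congrArg IntermediateAlgebra.carrier h))
    · intro N
      obtain ⟨E, hE⟩ := IntermediateExtension.exists_linfty_eq_carrier.{uΓ, uX, uY, w} hπ N
      exact ⟨⟦E⟧, IntermediateAlgebra.ext hE⟩

end CrossedProductLattice

end

theorem theorem3p6 {Γ : Type uΓ} [Group Γ] [Countable Γ]
    {X : Type uX} [MeasurableSpace X] [StandardBorelSpace X]
    {Y : Type uY} [MeasurableSpace Y] [StandardBorelSpace Y]
    (μ : Measure X) [IsProbabilityMeasure μ] (ν : Measure Y) [IsProbabilityMeasure ν]
    [MulAction Γ X] [NonsingularAction Γ μ] [MulAction Γ Y] [NonsingularAction Γ ν]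
    (hX : EssentiallyFree Γ μ) (hY : EssentiallyFree Γ ν)
    (π : Y → X) (hπ : IsFactorMap Γ ν μ π) :
    -- `Ψ` identifies (classes of) intermediate extensions `Z` with the algebras `L^∞(Z)`;
    -- `Φ` is the isomorphism `L^∞(Z) ↦ L^∞(Z) ⋊ Γ`.
    ∃ (Ψ : ExtensionClass.{uΓ, uX, uY, w} Γ μ ν π ≃ IntermediateAlgebra Γ μ ν π hπ.quasi)
      (Φ : IntermediateAlgebra Γ μ ν π hπ.quasi ≃o
        Set.Icc (crossedProduct Γ (Set.range (pullback π hπ.quasi)))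
          (crossedProduct Γ (Set.univ : Set (Lp ℂ ∞ ν)))),
      (∀ E : IntermediateExtension.{uΓ, uX, uY, w} Γ μ ν π,
        (Ψ ⟦E⟧).carrier = E.linfty ∧
        (Φ (Ψ ⟦E⟧)).1 = crossedProduct Γ E.linfty) ∧
      -- meets are intersections, on both sides
      (∀ N₁ N₂ : IntermediateAlgebra Γ μ ν π hπ.quasi,
        ∃ N : IntermediateAlgebra Γ μ ν π hπ.quasi,
          N.carrier = N₁.carrier ∩ N₂.carrier ∧
          ∀ T, T ∈ (Φ N).1 ↔ T ∈ (Φ N₁).1 ∧ T ∈ (Φ N₂).1) ∧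
      -- joins are generated von Neumann algebras, on both sides
      (∀ N₁ N₂ : IntermediateAlgebra Γ μ ν π hπ.quasi,
        ∃ N : IntermediateAlgebra Γ μ ν π hπ.quasi,
          mulOp '' N.carrier = generated (mulOp '' N₁.carrier ∪ mulOp '' N₂.carrier) ∧
          (Φ N).1 = generated ({T | T ∈ (Φ N₁).1} ∪ {T | T ∈ (Φ N₂).1})) := by
  refine ⟨extensionEquiv.{uΓ, uX, uY, w} hπ, crossedProductOrderIso hX hπ, fun E => ⟨rfl, rfl⟩,
    fun N₁ N₂ => ⟨N₁.inter N₂, rfl, fun T => N₁.mem_crossedProduct_inter_iff N₂⟩,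
    fun N₁ N₂ => ?_⟩
  obtain ⟨N, hN⟩ := N₁.exists_join N₂
  exact ⟨N, hN, crossedProductOrderIso_join hX hπ hN⟩
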